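/- Let $\rho=e^{2\pi i/3}$, $\tau=(1+\sqrt5)/2$ and $$Z_1=\begin{pmatrix}1&0&0\\0&-1&0\\0&0&-1\end{pmatrix},\quad Z_2=\begin{pmatrix}-1&0&0\\0&1&0\\0&0&-1\end{pmatrix},\quad T_1=\begin{pmatrix}0&0&1\\1&0&0\\0&1&0\end{pmatrix},$$ $$P=\frac12\begin{pmatrix}1&\tau^{-1}&-\tau\\ \tau^{-1}&\tau&1\\ \tau&-1&\tau^{-1}\end{pmatrix},\quad Q=\begin{pmatrix}1&0&0\\0&0&\rho^2\\0&-\rho&0\end{pmatrix}.$$ Let $\mathcal V\subset \mathrm{PGL}_3(\mathbb C)$ be the Valentiner group, i.e. the group generated by the classes of $Z_1,Z_2,T_1$ (which generate a tetrahedral group), $P$ (which extends it to an icosahedral group) and $Q$. Let $\mathcal V_{3\cdot 360}$ be the group of all matrices in $\mathrm{SU}_3$ whose class in $\mathrm{PGL}_3(\mathbb C)$ belongs to $\mathcal V$, and let $\mathcal V_{6\cdot 360}$ be the group generated by all unitary reflections of order two (unitary $g$ with $g^2=I$ and $\operatorname{rank}(g-I)=1$) whose class belongs to $\mathcal V$.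 For a finite group $\mathcal G\subset \mathrm{GL}_n(\mathbb C)$ the Molien series is the formal power series $$M(\mathcal G)=\sum_{m=0}^\infty\left(\dim_{\mathbb C}\mathbb C[x]_m^{\mathcal G}\right)t^m,$$ where $\mathbb C[x]_m^{\mathcal G}$ is the space of homogeneous polynomials $F$ of degree $m$ in $n$ variables with $F(T^{-1}x)=F(x)$ for all $T\in\mathcal G$. **Proposition.** The group $\mathcal V_{3\cdot 360}$ has order $1080$, the group $\mathcal V_{6\cdot 360}$ has order $2160$, and $$M(\mathcal V_{3\cdot 360})=\frac{1+t^{45}}{(1-t^6)(1-t^{12})(1-t^{30})}=1+t^6+2t^{12}+2t^{18}+\cdots+t^{45}+\cdots,$$ $$M(\mathcal V_{6\cdot 360})=\frac{1}{(1-t^6)(1-t^{12})(1-t^{30})}=1+t^6+2t^{12}+2t^{18}+\cdots .$$ Here the displayed initial terms give all coefficients up to degree $18$, and the coefficient of $t^{45}$ in $M(\mathcal V_{3\cdot 360})$ is $1$. -/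

import Mathlib

open scoped MatrixGroups

noncomputable section

namespace Valentiner

/-! ### Molien series of a finite linear group -/

section Molien

variable {n : ℕ}

/-- The linear substitution `F(x) ↦ F(A x)` on polynomials in `n` variables. -/
def linSubst (A : Matrix (Fin n) (Fin n) ℂ) :
    MvPolynomial (Fin n) ℂ →ₐ[ℂ] MvPolynomial (Fin n) ℂ :=
  MvPolynomial.aeval fun i => ∑ j, MvPolynomial.C (A i j) * MvPolynomial.X j

/-- The space `ℂ[x]_m^G` of homogeneous polynomials `F` of degree `m` such that
`F(T⁻¹ x) = F(x)` for all `T ∈ G`. -/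
def homogeneousInvariants (G : Subgroup (GL (Fin n) ℂ)) (m : ℕ) :
    Submodule ℂ (MvPolynomial (Fin n) ℂ) where
  carrier := {F | F.IsHomogeneous m ∧
    ∀ T ∈ G, linSubst ((T⁻¹ : GL (Fin n) ℂ) : Matrix (Fin n) (Fin n) ℂ) F = F}
  add_mem' := fun ha hb =>
    ⟨ha.1.add hb.1, fun T hT => by rw [map_add, ha.2 T hT, hb.2 T hT]⟩
  zero_mem' := ⟨MvPolynomial.isHomogeneous_zero _ _ _, fun _ _ => map_zero _⟩
  smul_mem' := fun c F hF =>
    ⟨(MvPolynomial.homogeneousSubmodule (Fin n) ℂ m).smul_mem c hF.1,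
      fun T hT => by rw [map_smul, hF.2 T hT]⟩

/-- The Molien series `∑ₘ (dim ℂ[x]_m^G) tᵐ`, as a formal power series. -/
def molienSeries (G : Subgroup (GL (Fin n) ℂ)) : PowerSeries ℚ :=
  PowerSeries.mk fun m => (Module.finrank ℂ (homogeneousInvariants G m) : ℚ)

end Molien

/-! ### The Valentiner group in `PGL(3, ℂ)` -/

/-- `ρ = e^{2πi/3}`. -/
def rho : ℂ := Complex.exp (2 * Real.pi * Complex.I / 3)

/-- `τ = (1 + √5)/2`. -/
def tau : ℂ := (1 + (Real.sqrt 5 : ℂ)) / 2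

theorem rho_pow_three : rho ^ 3 = 1 := by
  rw [rho, ← Complex.exp_nat_mul, ← Complex.exp_two_pi_mul_I]
  congr 1
  push_cast
  ring

theorem tau_sq : tau ^ 2 = tau + 1 := by
  have h : ((Real.sqrt 5 : ℝ) : ℂ) ^ 2 = 5 := by
    rw [← Complex.ofReal_pow, Real.sq_sqrt (by norm_num)]
    norm_num
  rw [tau]
  linear_combination h / 4

theorem tau_ne_zero : tau ≠ 0 := by
  intro h
  have := tau_sq
  rw [h] at this
  norm_num at this

def matZ1 : Matrix (Fin 3) (Fin 3) ℂ := !![1, 0, 0; 0, -1, 0; 0, 0, -1]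

def matZ2 : Matrix (Fin 3) (Fin 3) ℂ := !![-1, 0, 0; 0, 1, 0; 0, 0, -1]

def matT1 : Matrix (Fin 3) (Fin 3) ℂ := !![0, 0, 1; 1, 0, 0; 0, 1, 0]

def matP : Matrix (Fin 3) (Fin 3) ℂ :=
  (1 / 2 : ℂ) • !![1, tau⁻¹, -tau; tau⁻¹, tau, 1; tau, -1, tau⁻¹]

def matQ : Matrix (Fin 3) (Fin 3) ℂ := !![1, 0, 0; 0, 0, rho ^ 2; 0, -rho, 0]

theorem det_matZ1 : matZ1.det = 1 := by
  simp [matZ1, Matrix.det_fin_three]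

theorem det_matZ2 : matZ2.det = 1 := by
  simp [matZ2, Matrix.det_fin_three]

theorem det_matT1 : matT1.det = 1 := by
  simp [matT1, Matrix.det_fin_three]

theorem det_matP : matP.det = 1 := by
  have h := tau_sq
  have h0 := tau_ne_zero
  have hi : tau⁻¹ = tau - 1 := by
    field_simp
    linear_combination -h
  rw [matP, hi, Matrix.det_smul, Matrix.det_fin_three]
  simp
  linear_combination (3 / 4 : ℂ) * h

theorem det_matQ : matQ.det = 1 := by
  simp [matQ, Matrix.det_fin_three]
  linear_combination rho_pow_three

def Z1 : GL (Fin 3) ℂ := .mkOfDetNeZero matZ1 (by simp [det_matZ1])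

def Z2 : GL (Fin 3) ℂ := .mkOfDetNeZero matZ2 (by simp [det_matZ2])

def T1 : GL (Fin 3) ℂ := .mkOfDetNeZero matT1 (by simp [det_matT1])

def P : GL (Fin 3) ℂ := .mkOfDetNeZero matP (by simp [det_matP])

def Q : GL (Fin 3) ℂ := .mkOfDetNeZero matQ (by simp [det_matQ])

/-- The tetrahedral group of order 12 in `PGL(3, ℂ)`, consisting of the identity, the sign
changes and the signed cyclic permutations of determinant one. -/
def tetrahedralGroup : Subgroup PGL(3, ℂ) :=
  Subgroup.closure {Matrix.ProjGenLinGroup.mk Z1, Matrix.ProjGenLinGroup.mk Z2, Matrix.ProjGenLinGroup.mk T1}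

/-- The icosahedral group, generated by the tetrahedral group and `P`. -/
def icosahedralGroup : Subgroup PGL(3, ℂ) :=
  tetrahedralGroup ⊔ Subgroup.closure {Matrix.ProjGenLinGroup.mk P}

/-- The Valentiner group, generated by the icosahedral group and `Q`. -/
def valentinerGroup : Subgroup PGL(3, ℂ) :=
  icosahedralGroup ⊔ Subgroup.closure {Matrix.ProjGenLinGroup.mk Q}

/-! ### Its two linear lifts -/

/-- The lift of the Valentiner group to `SU(3)`: all matrices in `SU(3)` whose projective class
belongs to the Valentiner group. -/
def V3 : Subgroup (GL (Fin 3) ℂ) where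
  carrier := {g | (g : Matrix (Fin 3) (Fin 3) ℂ) ∈ Matrix.specialUnitaryGroup (Fin 3) ℂ ∧
    Matrix.ProjGenLinGroup.mk g ∈ valentinerGroup}
  mul_mem' := fun ha hb => ⟨mul_mem ha.1 hb.1, by
    rw [map_mul]
    exact mul_mem ha.2 hb.2⟩
  one_mem' := ⟨one_mem _, by
    rw [map_one]
    exact one_mem _⟩
  inv_mem' := fun {g} hg => ⟨by
    have hu := (Matrix.mem_specialUnitaryGroup_iff.mp hg.1).1
    have hd := (Matrix.mem_specialUnitaryGroup_iff.mp hg.1).2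
    have he : star (g : Matrix (Fin 3) (Fin 3) ℂ)
        = ((g⁻¹ : GL (Fin 3) ℂ) : Matrix (Fin 3) (Fin 3) ℂ) :=
      Units.eq_inv_of_mul_eq_one_right
        (Matrix.mem_unitaryGroup_iff'.mp hu)
    rw [← he]
    refine Matrix.mem_specialUnitaryGroup_iff.mpr ⟨Unitary.star_mem hu, ?_⟩
    rw [Matrix.star_eq_conjTranspose, Matrix.det_conjTranspose, hd, star_one], by
    rw [map_inv]
    exact inv_mem hg.2⟩

/-- A reflection of order two: an involution of `ℂⁿ` that fixes a hyperplane pointwise. -/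
def IsInvolutoryReflection {n : ℕ} (g : GL (Fin n) ℂ) : Prop :=
  g ^ 2 = 1 ∧ ((g : Matrix (Fin n) (Fin n) ℂ) - 1).rank = 1

/-- The involutory unitary reflections whose projective class belongs to the Valentiner group. -/
def valentinerReflections : Set (GL (Fin 3) ℂ) :=
  {g | (g : Matrix (Fin 3) (Fin 3) ℂ) ∈ Matrix.unitaryGroup (Fin 3) ℂ ∧
    IsInvolutoryReflection g ∧ Matrix.ProjGenLinGroup.mk g ∈ valentinerGroup}

/-- The unitary reflection group above the Valentiner group. -/
def V6 : Subgroup (GL (Fin 3) ℂ) := Subgroup.closure valentinerReflections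

end Valentiner

end

/-! Everything reduces to enumerating the group `linearValentiner` generated by the five given
matrices. Its elements have entries in ½ ℤ[τ, ρ], so their doubles are integer data on which
products and equality can be decided. The 36 monomial matrices generated by ρ, Z₁, Z₂, T₁ have 30
right cosets whose union is stable under right multiplication by the generators
(`cosetTable_correct`). A finite set stable in this way is stable under inverses too, so the union
is the whole group; the 36 · 30 = 1080 matrices are distinct by `elements_nodup` and
`Mat.ev_injective`.

A matrix in `V3` differs from one in `linearValentiner` by a scalar of determinant one, hence by a
cube root of unity, and (P Z₂ Q)⁴ = ρ. So the two groups coincide (`V3_eq_linearValentiner`).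

By Molien's formula the series is the mean of 1 / det(1 - t g⁻¹). For g in SU(3) this depends on the
trace alone, so the sum runs over a short table of traces with multiplicities. The nonzero traces
come in triples s, sρ, sρ² with s real; adding up a triple leaves a rational function of t³, and
`class_sum_identity` adds the results.

An involutory reflection has determinant -1, so its negative lies in `V3` and `V6` is contained in ±
`V3`. Conversely, -1 is obtained from three conjugate reflections, and the part of `V6` inside
`linearValentiner` is normal there; relations of coprime exponents make the quotient trivial. So
`V6` is ± `V3`, and since -1 acts on degree m by (-1)^m, its series is the even part of that of
`V3`. The denominator is even, so exactly the term t⁴⁵ of the numerator disappears. -/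

noncomputable section

namespace Valentiner

/-! ### Exact arithmetic in `ℤ[τ, ρ]` -/

/-- The element `a + b τ + (c + d τ) ρ` of `ℤ[τ, ρ]`. -/
@[ext] structure Quad where
  a : ℤ
  b : ℤ
  c : ℤ
  d : ℤ
deriving DecidableEq

namespace Quad

def ev (x : Quad) : ℂ := x.a + x.b * tau + (x.c + x.d * tau) * rho

def int (n : ℤ) : Quad := ⟨n, 0, 0, 0⟩

def add (x y : Quad) : Quad := ⟨x.a + y.a, x.b + y.b, x.c + y.c, x.d + y.d⟩

def neg (x : Quad) : Quad := ⟨-x.a, -x.b, -x.c, -x.d⟩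

def double (x : Quad) : Quad := x.add x

/-- Integer division is exact only on even coefficients. Matrices built with it are candidates,
confirmed by the doubling test in `Mat.chain`. -/
def half (x : Quad) : Quad := ⟨x.a / 2, x.b / 2, x.c / 2, x.d / 2⟩

def mul (x y : Quad) : Quad :=
  ⟨x.a * y.a + x.b * y.b - (x.c * y.c + x.d * y.d),
   x.a * y.b + x.b * y.a + x.b * y.b - (x.c * y.d + x.d * y.c + x.d * y.d),
   x.a * y.c + x.b * y.d + (x.c * y.a + x.d * y.b) - (x.c * y.c + x.d * y.d),
   x.a * y.d + x.b * y.c + x.b * y.d + (x.c * y.b + x.d * y.a + x.d * y.b)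
     - (x.c * y.d + x.d * y.c + x.d * y.d)⟩

def rhoMul (x : Quad) : Quad := ⟨-x.c, -x.d, x.a - x.c, x.b - x.d⟩

end Quad

/-! ### The numbers ρ and τ, and faithfulness of the integer coordinates -/

theorem rho_eq : rho = -1 / 2 + (Real.sqrt 3 / 2 : ℝ) * Complex.I := by
  have h : (2 * Real.pi * Complex.I / 3 : ℂ) = ((2 * Real.pi / 3 : ℝ) : ℂ) * Complex.I := by
    push_cast; ring
  have h2 : (2 * Real.pi / 3 : ℝ) = Real.pi - Real.pi / 3 := by ring
  rw [rho, h, Complex.exp_mul_I, ← Complex.ofReal_cos, ← Complex.ofReal_sin, h2, Real.cos_pi_sub,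
    Real.sin_pi_sub, Real.cos_pi_div_three, Real.sin_pi_div_three]
  push_cast
  ring

theorem rho_sq : rho ^ 2 = -1 - rho := by
  have h3 : ((Real.sqrt 3 : ℝ) : ℂ) ^ 2 = 3 := by
    rw [← Complex.ofReal_pow, Real.sq_sqrt (by norm_num)]; norm_num
  rw [rho_eq]
  push_cast
  linear_combination (Complex.I ^ 2 / 4) * h3 + (3 / 4) * Complex.I_sq

theorem star_rho : star rho = -1 - rho := by
  rw [rho_eq]
  apply Complex.ext <;> simp <;> norm_num

theorem star_tau : star tau = tau := by
  have h : tau = (((1 + Real.sqrt 5) / 2 : ℝ) : ℂ) := by rw [tau]; push_cast; rfl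
  rw [h]
  exact Complex.conj_ofReal _

theorem tau_inv : tau⁻¹ = tau - 1 := by
  have h0 := tau_ne_zero
  field_simp
  linear_combination -tau_sq

theorem int_add_int_mul_sqrt_five {m n : ℤ} (h : (m : ℝ) + n * Real.sqrt 5 = 0) :
    m = 0 ∧ n = 0 := by
  have hirr : Irrational (Real.sqrt 5) := by
    simpa using (show Nat.Prime 5 by norm_num).irrational_sqrt
  by_cases hn : n = 0
  · subst hn
    simpa using h
  · exfalso
    have h1 : Irrational ((m : ℝ) + n * Real.sqrt 5) := (hirr.intCast_mul hn).intCast_add m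
    rw [h] at h1
    exact not_irrational_zero h1

namespace Quad

theorem ev_int (n : ℤ) : (int n).ev = n := by simp [ev, int]

theorem ev_add (x y : Quad) : (x.add y).ev = x.ev + y.ev := by
  simp only [ev, add]; push_cast; ring

theorem ev_neg (x : Quad) : x.neg.ev = -x.ev := by
  simp only [ev, neg]; push_cast; ring

theorem ev_double (x : Quad) : x.double.ev = 2 * x.ev := by
  rw [double, ev_add]; ring

theorem ev_mul (x y : Quad) : (x.mul y).ev = x.ev * y.ev := by
  simp only [ev, mul]
  push_cast
  linear_combination
    (-((x.b : ℂ) * y.b) - ((x.b : ℂ) * y.d + x.d * y.b) * rho - (x.d : ℂ) * y.d * rho ^ 2) * tau_sq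
      - ((x.c : ℂ) * y.c + (x.c * y.d + x.d * y.c) * tau + x.d * y.d * (tau + 1)) * rho_sq

theorem ev_rhoMul (x : Quad) : x.rhoMul.ev = rho * x.ev := by
  simp only [ev, rhoMul]
  push_cast
  linear_combination (-(x.c : ℂ) - x.d * tau) * rho_sq

/-- 1 and ρ are independent over ℝ, and 1 and τ over ℚ. This lets distinct integer codes count as
distinct complex numbers. -/
theorem ev_injective : Function.Injective ev := by
  intro x y h
  have hs : (0 : ℝ) < Real.sqrt 3 := Real.sqrt_pos.mpr (by norm_num)
  have e : ∀ z : Quad, z.ev = (((z.a + z.b / 2 - z.c / 2 - z.d / 4 : ℝ) +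
      (z.b / 2 - z.d / 4) * Real.sqrt 5 : ℝ) : ℂ) +
      ((Real.sqrt 3 / 2 * (z.c + z.d / 2 + z.d / 2 * Real.sqrt 5) : ℝ) : ℂ) * Complex.I := by
    intro z
    simp only [ev, rho_eq, tau]
    push_cast
    ring
  rw [e x, e y] at h
  have hre := congrArg Complex.re h
  have him := congrArg Complex.im h
  simp only [Complex.add_re, Complex.add_im, Complex.ofReal_re, Complex.ofReal_im,
    Complex.mul_re, Complex.mul_im, Complex.I_re, Complex.I_im] at hre him
  ring_nf at hre him
  have him' : (x.c : ℝ) + x.d / 2 + x.d / 2 * Real.sqrt 5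
      = y.c + y.d / 2 + y.d / 2 * Real.sqrt 5 := by
    apply mul_left_cancel₀ hs.ne'
    linarith
  -- Twice the equation of imaginary parts, divided by √3 / 2, has the form m + n√5 = 0 with
  -- integers m and n; the real parts are treated likewise once c and d agree.
  have h1 := int_add_int_mul_sqrt_five (m := 2 * (x.c - y.c) + (x.d - y.d)) (n := x.d - y.d)
    (by push_cast; linarith)
  have hd : x.d = y.d := by omega
  have hc : x.c = y.c := by omega
  rw [hc, hd] at hre
  have h2 := int_add_int_mul_sqrt_five (m := 2 * (x.a - y.a) + (x.b - y.b)) (n := x.b - y.b)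
    (by push_cast; linarith)
  ext <;> omega

end Quad

/-! ### Doubled 3 × 3 matrices over ℤ[τ, ρ] -/

@[ext] structure Vec where
  x : Quad
  y : Quad
  z : Quad
deriving DecidableEq

namespace Vec

def map (f : Quad → Quad) (v : Vec) : Vec := ⟨f v.x, f v.y, f v.z⟩

def add (v w : Vec) : Vec := ⟨v.x.add w.x, v.y.add w.y, v.z.add w.z⟩

end Vec

/-- The rows of twice a matrix with entries in `½ ℤ[τ, ρ]`. -/
@[ext] structure Mat where
  x : Vec
  y : Vec
  z : Vec
deriving DecidableEq

def Vec.mulMat (v : Vec) (B : Mat) : Vec :=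
  ((B.x.map v.x.mul).add (B.y.map v.y.mul)).add (B.z.map v.z.mul)

namespace Mat

def ev (A : Mat) : Matrix (Fin 3) (Fin 3) ℂ :=
  (1 / 2 : ℂ) • !![A.x.x.ev, A.x.y.ev, A.x.z.ev; A.y.x.ev, A.y.y.ev, A.y.z.ev;
    A.z.x.ev, A.z.y.ev, A.z.z.ev]

def map (f : Quad → Quad) (A : Mat) : Mat := ⟨A.x.map f, A.y.map f, A.z.map f⟩

/-- The product of two doubled matrices is four times the true product, so it has to be halved once
to be a code again; hence the tests of the form `A.mul B = C.map .double`. -/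
def mul (A B : Mat) : Mat := ⟨A.x.mulMat B, A.y.mulMat B, A.z.mulMat B⟩

def prod (A B : Mat) : Mat := (A.mul B).map Quad.half

def rotate (A : Mat) : Mat := ⟨A.z, A.x, A.y⟩

def flip₁ (A : Mat) : Mat := ⟨A.x, A.y.map Quad.neg, A.z.map Quad.neg⟩

def flip₂ (A : Mat) : Mat := ⟨A.x.map Quad.neg, A.y, A.z.map Quad.neg⟩

def one : Mat := ⟨⟨.int 2, .int 0, .int 0⟩, ⟨.int 0, .int 2, .int 0⟩, ⟨.int 0, .int 0, .int 2⟩⟩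

def Z1 : Mat := one.flip₁

def Z2 : Mat := one.flip₂

def T1 : Mat := one.rotate

def P : Mat :=
  ⟨⟨.int 1, ⟨-1, 1, 0, 0⟩, ⟨0, -1, 0, 0⟩⟩, ⟨⟨-1, 1, 0, 0⟩, ⟨0, 1, 0, 0⟩, .int 1⟩,
    ⟨⟨0, 1, 0, 0⟩, .int (-1), ⟨-1, 1, 0, 0⟩⟩⟩

def Q : Mat :=
  ⟨⟨.int 2, .int 0, .int 0⟩, ⟨.int 0, .int 0, ⟨-2, 0, -2, 0⟩⟩, ⟨.int 0, ⟨0, 0, -2, 0⟩, .int 0⟩⟩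

/-- The scalar matrix `ρ`. -/
def R : Mat := one.map .rhoMul

theorem ev_one : one.ev = 1 := by
  ext i j
  fin_cases i <;> fin_cases j <;> simp [ev, one, Quad.ev_int]

theorem ev_Z1 : Z1.ev = matZ1 := by
  ext i j
  fin_cases i <;> fin_cases j <;>
    simp [ev, Z1, one, flip₁, Vec.map, matZ1, Quad.ev_neg, Quad.ev_int]

theorem ev_Z2 : Z2.ev = matZ2 := by
  ext i j
  fin_cases i <;> fin_cases j <;>
    simp [ev, Z2, one, flip₂, Vec.map, matZ2, Quad.ev_neg, Quad.ev_int]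

theorem ev_T1 : T1.ev = matT1 := by
  ext i j
  fin_cases i <;> fin_cases j <;> simp [ev, T1, one, rotate, matT1, Quad.ev_int]

theorem ev_P : P.ev = matP := by
  ext i j
  fin_cases i <;> fin_cases j <;>
    simp [ev, P, matP, Quad.ev, Quad.int, tau_inv] <;> ring

theorem ev_Q : Q.ev = matQ := by
  ext i j
  fin_cases i <;> fin_cases j <;>
    simp [ev, Q, matQ, Quad.ev, Quad.int, rho_sq] <;> ring

theorem ev_R : R.ev = rho • (1 : Matrix (Fin 3) (Fin 3) ℂ) := by
  ext i j
  fin_cases i <;> fin_cases j <;>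
    simp [ev, R, one, map, Vec.map, Quad.ev_rhoMul, Quad.ev_int, mul_left_comm]

theorem ev_injective : Function.Injective ev := by
  intro A B h
  have e : ∀ i j, (2 : ℂ) * A.ev i j = 2 * B.ev i j := fun i j => by rw [h]
  ext : 2 <;> apply Quad.ev_injective
  · simpa [ev] using e 0 0
  · simpa [ev] using e 0 1
  · simpa [ev] using e 0 2
  · simpa [ev] using e 1 0
  · simpa [ev] using e 1 1
  · simpa [ev] using e 1 2
  · simpa [ev] using e 2 0
  · simpa [ev] using e 2 1
  · simpa [ev] using e 2 2

theorem ev_mul_ev (A B : Mat) : A.ev * B.ev = (1 / 2 : ℂ) • (A.mul B).ev := by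
  ext i j
  fin_cases i <;> fin_cases j <;>
    simp [ev, mul, Vec.mulMat, Vec.map, Vec.add, Quad.ev_mul, Quad.ev_add, Matrix.mul_apply,
      Fin.sum_univ_three] <;> ring

theorem ev_map_double (A : Mat) : (A.map .double).ev = (2 : ℂ) • A.ev := by
  ext i j
  fin_cases i <;> fin_cases j <;> simp [ev, map, Vec.map, Quad.ev_double]

theorem ev_eq_mul {A B C : Mat} (h : A.mul B = C.map .double) : C.ev = A.ev * B.ev := by
  rw [ev_mul_ev, h, ev_map_double, smul_smul]
  norm_num

theorem ev_rotate (A : Mat) : A.rotate.ev = T1.ev * A.ev := by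
  rw [ev_T1]
  ext i j
  fin_cases i <;> fin_cases j <;>
    simp [ev, rotate, matT1, Matrix.mul_apply, Fin.sum_univ_three]

theorem ev_flip₁ (A : Mat) : A.flip₁.ev = Z1.ev * A.ev := by
  rw [ev_Z1]
  ext i j
  fin_cases i <;> fin_cases j <;>
    simp [ev, flip₁, matZ1, Vec.map, Quad.ev_neg, Matrix.mul_apply, Fin.sum_univ_three]

theorem ev_flip₂ (A : Mat) : A.flip₂.ev = Z2.ev * A.ev := by
  rw [ev_Z2]
  ext i j
  fin_cases i <;> fin_cases j <;>
    simp [ev, flip₂, matZ2, Vec.map, Quad.ev_neg, Matrix.mul_apply, Fin.sum_univ_three]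

theorem ev_map_rhoMul (A : Mat) : (A.map .rhoMul).ev = R.ev * A.ev := by
  rw [ev_R]
  ext i j
  fin_cases i <;> fin_cases j <;>
    simp [ev, map, Vec.map, Quad.ev_rhoMul] <;> ring

/-- The product of a list of matrices, provided that all partial products have entries in
`½ ℤ[τ, ρ]`. -/
def chain : List Mat → Option Mat
  | [] => some one
  | A :: l => (chain l).bind fun B =>
      if A.mul B = (A.prod B).map .double then some (A.prod B) else none

theorem ev_chain : ∀ {l : List Mat} {C : Mat}, chain l = some C → C.ev = (l.map ev).prod
  | [], C, h => by
    simp only [chain, Option.some.injEq] at h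
    simp [← h, ev_one]
  | A :: l, C, h => by
    rw [chain, Option.bind_eq_some_iff] at h
    obtain ⟨B, hB, h⟩ := h
    split_ifs at h with hAB
    simp only [Option.some.injEq] at h
    rw [List.map_cons, List.prod_cons, ← ev_chain hB, ← h, ev_eq_mul hAB]

/-- Twice the trace. -/
def tr (A : Mat) : Quad := A.x.x.add (A.y.y.add A.z.z)

theorem trace_ev (A : Mat) : A.ev.trace = A.tr.ev / 2 := by
  simp [ev, tr, Matrix.trace_fin_three, Quad.ev_add]
  ring

end Mat

/-! ### The linear group generated by the five matrices -/

/-- The group generated by the matrices `Z₁`, `Z₂`, `T₁`, `P`, `Q`. -/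
def linearValentiner : Subgroup (GL (Fin 3) ℂ) := Subgroup.closure {Z1, Z2, T1, P, Q}

/-- The scalar matrix `ρ`. -/
def R : GL (Fin 3) ℂ := (P * Z2 * Q) ^ 4

theorem R_mem : R ∈ linearValentiner :=
  pow_mem (mul_mem (mul_mem (Subgroup.subset_closure (by simp)) (Subgroup.subset_closure (by simp)))
    (Subgroup.subset_closure (by simp))) 4

theorem coe_Z1 : (Z1 : Matrix (Fin 3) (Fin 3) ℂ) = Mat.Z1.ev := Mat.ev_Z1.symm

theorem coe_Z2 : (Z2 : Matrix (Fin 3) (Fin 3) ℂ) = Mat.Z2.ev := Mat.ev_Z2.symm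

theorem coe_T1 : (T1 : Matrix (Fin 3) (Fin 3) ℂ) = Mat.T1.ev := Mat.ev_T1.symm

theorem coe_P : (P : Matrix (Fin 3) (Fin 3) ℂ) = Mat.P.ev := Mat.ev_P.symm

theorem coe_Q : (Q : Matrix (Fin 3) (Fin 3) ℂ) = Mat.Q.ev := Mat.ev_Q.symm

theorem coe_R : (R : Matrix (Fin 3) (Fin 3) ℂ) = Mat.R.ev := by
  have h : Mat.chain (List.replicate 4 [Mat.P, Mat.Z2, Mat.Q]).flatten = some Mat.R := by
    decide +kernel
  rw [Mat.ev_chain h]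
  simp [R, coe_P, coe_Z2, coe_Q, pow_succ, List.replicate, mul_assoc]

theorem coe_R_eq_smul : (R : Matrix (Fin 3) (Fin 3) ℂ) = rho • 1 := by
  rw [coe_R, Mat.ev_R]

/-- The numerical matrices that represent elements of the group generated by `Z₁, Z₂, T₁, P, Q`. -/
def Represents (A : Mat) : Prop := ∃ g ∈ linearValentiner, (g : Matrix (Fin 3) (Fin 3) ℂ) = A.ev

def generators : List Mat := [.Z1, .Z2, .T1, .P, .Q]

theorem represents_of_mem_generators {A : Mat} (h : A ∈ generators) : Represents A := by
  simp only [generators, List.mem_cons, List.not_mem_nil, or_false] at h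
  rcases h with rfl | rfl | rfl | rfl | rfl
  · exact ⟨Z1, Subgroup.subset_closure (by simp), coe_Z1⟩
  · exact ⟨Z2, Subgroup.subset_closure (by simp), coe_Z2⟩
  · exact ⟨T1, Subgroup.subset_closure (by simp), coe_T1⟩
  · exact ⟨P, Subgroup.subset_closure (by simp), coe_P⟩
  · exact ⟨Q, Subgroup.subset_closure (by simp), coe_Q⟩

theorem represents_chain {l : List Mat} (hl : ∀ A ∈ l, A ∈ generators) {C : Mat}
    (h : Mat.chain l = some C) : Represents C := by
  have key : ∀ l : List Mat, (∀ A ∈ l, A ∈ generators) →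
      ∃ g ∈ linearValentiner, (g : Matrix (Fin 3) (Fin 3) ℂ) = (l.map Mat.ev).prod := by
    intro l
    induction l with
    | nil => exact fun _ => ⟨1, one_mem _, by simp⟩
    | cons A l ih =>
      intro hl
      obtain ⟨g, hg, hgA⟩ := represents_of_mem_generators (hl A (by simp))
      obtain ⟨k, hk, hkl⟩ := ih fun B hB => hl B (by simp [hB])
      exact ⟨g * k, mul_mem hg hk, by simp [hgA, hkl]⟩
  obtain ⟨g, hg, hgl⟩ := key l hl
  exact ⟨g, hg, by rw [hgl, Mat.ev_chain h]⟩

/-- Left multiplications by the 36 monomial matrices generated by `ρ`, `Z₁`, `Z₂`, `T₁`. -/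
def leftOps : List (Mat → Mat) :=
  [id, Mat.rotate, Mat.rotate ∘ Mat.rotate].flatMap fun f =>
    [id, Mat.flip₁, Mat.flip₂, Mat.flip₁ ∘ Mat.flip₂].flatMap fun g =>
      [id, Mat.map .rhoMul, Mat.map .rhoMul ∘ Mat.map .rhoMul].map fun h => h ∘ g ∘ f

/-- `f` is left multiplication by an element of the group. -/
def IsLeftMul (f : Mat → Mat) : Prop :=
  ∃ g ∈ linearValentiner, ∀ A, (f A).ev = (g : Matrix (Fin 3) (Fin 3) ℂ) * A.ev

theorem IsLeftMul.id : IsLeftMul id := ⟨1, one_mem _, fun A => by simp⟩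

theorem IsLeftMul.comp {f g : Mat → Mat} (hf : IsLeftMul f) (hg : IsLeftMul g) :
    IsLeftMul (f ∘ g) := by
  obtain ⟨a, ha, hfa⟩ := hf
  obtain ⟨b, hb, hgb⟩ := hg
  exact ⟨a * b, mul_mem ha hb, fun A => by simp [hfa, hgb, mul_assoc]⟩

theorem IsLeftMul.rotate : IsLeftMul Mat.rotate :=
  ⟨T1, Subgroup.subset_closure (by simp), fun A => by rw [Mat.ev_rotate, coe_T1]⟩

theorem IsLeftMul.flip₁ : IsLeftMul Mat.flip₁ :=
  ⟨Z1, Subgroup.subset_closure (by simp), fun A => by rw [Mat.ev_flip₁, coe_Z1]⟩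

theorem IsLeftMul.flip₂ : IsLeftMul Mat.flip₂ :=
  ⟨Z2, Subgroup.subset_closure (by simp), fun A => by rw [Mat.ev_flip₂, coe_Z2]⟩

theorem IsLeftMul.rhoMul : IsLeftMul (Mat.map .rhoMul) :=
  ⟨R, R_mem, fun A => by rw [Mat.ev_map_rhoMul, coe_R]⟩

theorem isLeftMul_of_mem_leftOps {f : Mat → Mat} (h : f ∈ leftOps) : IsLeftMul f := by
  simp only [leftOps, List.mem_flatMap, List.mem_map] at h
  obtain ⟨f₁, h₁, f₂, h₂, f₃, h₃, rfl⟩ := h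
  refine IsLeftMul.comp ?_ (IsLeftMul.comp ?_ ?_)
  · simp only [List.mem_cons, List.not_mem_nil, or_false] at h₃
    rcases h₃ with rfl | rfl | rfl
    exacts [.id, .rhoMul, .comp .rhoMul .rhoMul]
  · simp only [List.mem_cons, List.not_mem_nil, or_false] at h₂
    rcases h₂ with rfl | rfl | rfl | rfl
    exacts [.id, .flip₁, .flip₂, .comp .flip₁ .flip₂]
  · simp only [List.mem_cons, List.not_mem_nil, or_false] at h₁
    rcases h₁ with rfl | rfl | rfl
    exacts [.id, .rotate, .comp .rotate .rotate]

/-- Left multiplication is determined by the image of the identity. -/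
theorem IsLeftMul.ev_apply {f : Mat → Mat} (hf : IsLeftMul f) (A : Mat) :
    (f A).ev = (f .one).ev * A.ev := by
  obtain ⟨g, -, hg⟩ := hf
  rw [hg, hg .one, Mat.ev_one, mul_one]

/-- Coset representatives of the icosahedral group modulo the tetrahedral group, as words. -/
def icosahedralWords : List (List Mat) := [[], [.P], [.P, .Z1], [.P, .Z2], [.P, .Z1, .Z2]]

/-- Coset representatives modulo the monomial group of order 36, as words. -/
def cosetWords : List (List Mat) :=
  icosahedralWords ++ icosahedralWords.flatMap fun u => icosahedralWords.map fun v => u ++ .Q :: v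

/-- With H the icosahedral group, the Valentiner group is H ∪ HQH, which accounts for 5 + 5 · 5
representatives u and uQv. `filterMap` would silently drop a word whose `chain` fails;
`length_elements` shows that none is lost. -/
def cosetReps : List Mat := cosetWords.filterMap Mat.chain

@[irreducible] def elements : List Mat := cosetReps.flatMap fun A => leftOps.map fun f => f A

theorem mem_elements {B : Mat} : B ∈ elements ↔ ∃ A ∈ cosetReps, ∃ f ∈ leftOps, f A = B := by
  simp [elements]

theorem represents_of_mem_elements {B : Mat} (h : B ∈ elements) : Represents B := by
  obtain ⟨A, hA, f, hf, rfl⟩ := mem_elements.mp h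
  obtain ⟨w, hw, hwA⟩ := List.mem_filterMap.mp hA
  have hall : ∀ w ∈ cosetWords, ∀ A ∈ w, A ∈ generators := by decide +kernel
  obtain ⟨g, hg, hgA⟩ := represents_chain (hall w hw) hwA
  obtain ⟨k, hk, hkf⟩ := isLeftMul_of_mem_leftOps hf
  exact ⟨k * g, mul_mem hk hg, by rw [hkf, Units.val_mul, hgA]⟩

/-! ### Closure under right multiplication by the generators -/

def all₂ {α β : Type*} (p : α → β → Bool) : List α → List β → Bool
  | [], _ => true
  | _ :: _, [] => false
  | a :: l, b :: m => p a b && all₂ p l m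

theorem exists_of_all₂ {α β : Type*} {p : α → β → Bool} :
    ∀ {l : List α} {m : List β}, all₂ p l m = true → ∀ a ∈ l, ∃ b, p a b = true
  | [], _, _, _, ha => absurd ha List.not_mem_nil
  | _ :: _, [], h, _, _ => by simp [all₂] at h
  | a :: l, b :: m, h, c, hc => by
    rw [all₂, Bool.and_eq_true] at h
    rcases List.mem_cons.mp hc with rfl | hc
    · exact ⟨b, h.1⟩
    · exact exists_of_all₂ h.2 c hc

/-- The coset table: the pair `(k, j)` in row `i` and column `g` says that the product of the `i`th
representative and the generator `g` is the `k`th monomial matrix times the `j`th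
representative. -/
def cosetTable : List (List (ℕ × ℕ)) :=
  [[(3, 0), (6, 0), (12, 0), (0, 1), (0, 5)],
   [(0, 2), (0, 3), (33, 3), (27, 3), (0, 10)],
   [(0, 1), (0, 4), (33, 2), (18, 4), (0, 15)],
   [(0, 4), (0, 1), (33, 4), (3, 2), (0, 20)],
   [(0, 3), (0, 2), (33, 1), (9, 0), (0, 25)],
   [(3, 5), (9, 5), (28, 5), (0, 6), (3, 0)],
   [(0, 7), (0, 8), (14, 8), (23, 8), (6, 18)],
   [(0, 6), (0, 9), (14, 7), (31, 9), (6, 19)],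
   [(0, 9), (0, 6), (14, 9), (3, 7), (6, 17)],
   [(0, 8), (0, 7), (14, 6), (6, 5), (6, 16)],
   [(0, 15), (0, 25), (16, 15), (0, 11), (0, 2)],
   [(0, 12), (0, 13), (35, 23), (35, 13), (3, 13)],
   [(0, 11), (0, 14), (35, 22), (16, 14), (3, 14)],
   [(0, 14), (0, 11), (35, 24), (0, 17), (3, 12)],
   [(0, 13), (0, 12), (35, 21), (0, 20), (3, 11)],
   [(0, 10), (0, 20), (16, 25), (0, 16), (0, 1)],
   [(0, 17), (0, 18), (35, 18), (35, 28), (6, 8)],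
   [(0, 16), (0, 19), (35, 17), (16, 24), (6, 9)],
   [(0, 19), (0, 16), (35, 19), (0, 12), (6, 7)],
   [(0, 18), (0, 17), (35, 16), (0, 25), (6, 6)],
   [(0, 25), (0, 15), (16, 20), (0, 21), (0, 4)],
   [(0, 22), (0, 23), (35, 28), (35, 18), (27, 28)],
   [(0, 21), (0, 24), (35, 27), (16, 29), (27, 29)],
   [(0, 24), (0, 21), (35, 29), (0, 27), (27, 27)],
   [(0, 23), (0, 22), (35, 26), (0, 10), (27, 26)],
   [(0, 20), (0, 10), (16, 10), (0, 26), (0, 3)],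
   [(0, 27), (0, 28), (35, 13), (35, 23), (18, 23)],
   [(0, 26), (0, 29), (35, 12), (16, 19), (18, 24)],
   [(0, 29), (0, 26), (35, 14), (0, 22), (18, 22)],
   [(0, 28), (0, 27), (35, 11), (0, 15), (18, 21)]]

theorem cosetTable_correct : all₂ (fun A => all₂ (fun g kj =>
    match leftOps[kj.1]?, cosetReps[kj.2]? with
    | some f, some B => A.mul g == (f B).map .double
    | _, _ => false) generators) cosetReps cosetTable = true := by
  decide +kernel

theorem exists_of_mem_cosetReps {A g : Mat} (hA : A ∈ cosetReps) (hg : g ∈ generators) :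
    ∃ f ∈ leftOps, ∃ B ∈ cosetReps, A.ev * g.ev = (f B).ev := by
  obtain ⟨row, hrow⟩ := exists_of_all₂ cosetTable_correct A hA
  obtain ⟨kj, h⟩ := exists_of_all₂ hrow g hg
  split at h
  · next f B hf hB =>
    exact ⟨f, List.mem_of_getElem? hf, B, List.mem_of_getElem? hB,
      (Mat.ev_eq_mul (beq_iff_eq.mp h)).symm⟩
  · exact absurd h (by simp)

/-- A left multiplication is determined by its value at the identity, so comparing matrices there is
enough to identify a composite of two operations. -/
theorem leftOps_closed : (leftOps.all fun f => leftOps.all fun g => leftOps.any fun h =>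
    f (g .one) == h .one) = true := by
  decide +kernel

theorem exists_comp_of_mem_leftOps {f g : Mat → Mat} (hf : f ∈ leftOps) (hg : g ∈ leftOps) :
    ∃ h ∈ leftOps, ∀ A, f (g A) = h A := by
  have key := leftOps_closed
  rw [List.all_eq_true] at key
  have key := key f hf
  rw [List.all_eq_true] at key
  obtain ⟨h, hh, e⟩ := List.any_eq_true.mp (key g hg)
  refine ⟨h, hh, fun A => Mat.ev_injective ?_⟩
  have e' := congrArg Mat.ev (beq_iff_eq.mp e)
  have hf' := isLeftMul_of_mem_leftOps hf
  have hg' := isLeftMul_of_mem_leftOps hg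
  rw [(isLeftMul_of_mem_leftOps hh).ev_apply, ← e', hf'.ev_apply (g A), hg'.ev_apply A,
    hf'.ev_apply (g .one), mul_assoc]

theorem exists_mem_elements_mul {A g : Mat} (hA : A ∈ elements) (hg : g ∈ generators) :
    ∃ B ∈ elements, A.ev * g.ev = B.ev := by
  obtain ⟨A', hA', f, hf, rfl⟩ := mem_elements.mp hA
  obtain ⟨k, hk, B, hB, e⟩ := exists_of_mem_cosetReps hA' hg
  obtain ⟨h, hh, eh⟩ := exists_comp_of_mem_leftOps hf hk
  refine ⟨h B, mem_elements.mpr ⟨B, hB, h, hh, rfl⟩, ?_⟩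
  rw [(isLeftMul_of_mem_leftOps hf).ev_apply, mul_assoc, e, ← eh,
    (isLeftMul_of_mem_leftOps hf).ev_apply (k B)]

theorem one_mem_elements : Mat.one ∈ elements := by
  have h : elements.head? = some Mat.one := by decide +kernel
  exact List.mem_of_head? h

/-! ### Enumeration of the group -/

theorem exists_mem_elements {g : GL (Fin 3) ℂ} (hg : g ∈ linearValentiner) :
    ∃ A ∈ elements, (g : Matrix (Fin 3) (Fin 3) ℂ) = A.ev := by
  set S : Set (GL (Fin 3) ℂ) := {g | ∃ A ∈ elements, (g : Matrix (Fin 3) (Fin 3) ℂ) = A.ev} with hS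
  have hfin : S.Finite := by
    refine Set.Finite.of_finite_image (f := fun g : GL (Fin 3) ℂ => (g : Matrix (Fin 3) (Fin 3) ℂ))
      (Set.Finite.subset ((List.finite_toSet elements).image Mat.ev) ?_)
      (fun a _ b _ h => Units.ext h)
    rintro _ ⟨g, ⟨A, hA, e⟩, rfl⟩
    exact ⟨A, hA, e.symm⟩
  have hmul : ∀ s ∈ ({Z1, Z2, T1, P, Q} : Set (GL (Fin 3) ℂ)), Set.MapsTo (· * s) S S := by
    rintro s hs a ⟨A, hA, e⟩
    have : ∃ B ∈ generators, (s : Matrix (Fin 3) (Fin 3) ℂ) = B.ev := by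
      simp only [Set.mem_insert_iff, Set.mem_singleton_iff] at hs
      rcases hs with rfl | rfl | rfl | rfl | rfl
      exacts [⟨_, by simp [generators], coe_Z1⟩, ⟨_, by simp [generators], coe_Z2⟩,
        ⟨_, by simp [generators], coe_T1⟩, ⟨_, by simp [generators], coe_P⟩,
        ⟨_, by simp [generators], coe_Q⟩]
    obtain ⟨B, hB, eB⟩ := this
    obtain ⟨C, hC, eC⟩ := exists_mem_elements_mul hA hB
    exact ⟨C, hC, by rw [Units.val_mul, e, eB, eC]⟩
  change g ∈ S
  induction hg using Subgroup.closure_induction_right with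
  | one => exact ⟨.one, one_mem_elements, by simp [Mat.ev_one]⟩
  | mul_right x _ y hy hx => exact hmul y hy hx
  | mul_inv_cancel x _ y hy hx =>
    -- An injective self-map of a finite set is onto, so stability under a generator gives stability
    -- under its inverse.
    have hsurj : Set.SurjOn (· * y) S S :=
      ((hfin.injOn_iff_bijOn_of_mapsTo (hmul y hy)).mp (mul_left_injective y).injOn).surjOn
    obtain ⟨z, hz, e⟩ := hsurj hx
    rw [← e]
    simpa using hz

/-- A numerical fingerprint that separates the elements of the group. -/
def Quad.key (x : Quad) (n : ℤ) : ℤ := x.a + 11 * (x.b + 11 * (x.c + 11 * (x.d + 11 * n)))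

def Vec.key (v : Vec) (n : ℤ) : ℤ := v.x.key (v.y.key (v.z.key n))

/-- Only the absence of collisions on `elements` matters, and this is decided in `elements_nodup`.
Reduction modulo 70009 keeps the bit mask of `nodupTest` short. -/
def Mat.key (A : Mat) : ℕ := (A.x.key (A.y.key (A.z.key 0)) % 70009).toNat

/-- Tests that a list of numbers has no duplicates and avoids the binary digits of `m`. -/
def nodupTest : List ℕ → ℕ → Bool
  | [], _ => true
  | k :: l, m => !m.testBit k && nodupTest l (m ||| 1 <<< k)

theorem nodup_of_nodupTest : ∀ {l : List ℕ} {m : ℕ}, nodupTest l m = true →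
    l.Nodup ∧ ∀ k ∈ l, m.testBit k = false
  | [], _, _ => by simp
  | k :: l, m, h => by
    rw [nodupTest, Bool.and_eq_true] at h
    obtain ⟨h₁, h₂⟩ := nodup_of_nodupTest h.2
    have h₃ : ∀ j ∈ l, m.testBit j = false ∧ k ≠ j := by
      intro j hj
      have := h₂ j hj
      simpa [Nat.testBit_or, Nat.testBit_shiftLeft, Nat.one_shiftLeft, Nat.testBit_two_pow]
        using this
    refine ⟨List.nodup_cons.mpr ⟨fun hk => (h₃ k hk).2 rfl, h₁⟩, fun j hj => ?_⟩
    rcases List.mem_cons.mp hj with rfl | hj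
    · simpa using h.1
    · exact (h₃ j hj).1

theorem elements_nodup : elements.Nodup := by
  have h : nodupTest (elements.map Mat.key) 0 = true := by decide +kernel
  exact List.Nodup.of_map _ (nodup_of_nodupTest h).1

theorem length_elements : elements.length = 1080 := by decide +kernel

/-- The (doubled) traces of the elements of the group, with multiplicities. -/
def traceTable : List (Quad × ℕ) :=
  [(⟨0, 0, 0, 0⟩, 240), (⟨6, 0, 0, 0⟩, 1), (⟨0, 0, 6, 0⟩, 1), (⟨-6, 0, -6, 0⟩, 1),
    (⟨-2, 0, 0, 0⟩, 45), (⟨0, 0, -2, 0⟩, 45), (⟨2, 0, 2, 0⟩, 45),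
    (⟨2, 0, 0, 0⟩, 90), (⟨0, 0, 2, 0⟩, 90), (⟨-2, 0, -2, 0⟩, 90),
    (⟨0, 2, 0, 0⟩, 72), (⟨0, 0, 0, 2⟩, 72), (⟨0, -2, 0, -2⟩, 72),
    (⟨2, -2, 0, 0⟩, 72), (⟨0, 0, 2, -2⟩, 72), (⟨-2, 2, -2, 2⟩, 72)]

theorem count_traceTable :
    (traceTable.all fun p => (elements.map Mat.tr).count p.1 == p.2) = true := by
  decide +kernel

theorem mem_traceTable :
    ((elements.map Mat.tr).all fun x => decide (x ∈ traceTable.map Prod.fst)) = true := by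
  decide +kernel

theorem sum_elements_tr {M : Type*} [AddCommMonoid M] (F : Quad → M) :
    (elements.map fun A => F A.tr).sum = (traceTable.map fun p => p.2 • F p.1).sum := by
  have h₁ : (elements.map fun A => F A.tr) = (elements.map Mat.tr).map F := by simp
  rw [h₁, Finset.sum_list_map_count]
  have hnd : (traceTable.map Prod.fst).Nodup := by decide +kernel
  rw [Finset.sum_subset (s₂ := (traceTable.map Prod.fst).toFinset)]
  · rw [List.sum_toFinset _ hnd, List.map_map]
    refine congrArg List.sum (List.map_congr_left fun p hp => ?_)
    have := List.all_eq_true.mp count_traceTable p hp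
    simp only [Function.comp_apply, beq_iff_eq.mp this]
  · intro x hx
    simpa using List.all_eq_true.mp mem_traceTable x (List.mem_toFinset.mp hx)
  · intro x _ hx
    rw [List.count_eq_zero_of_not_mem (by simpa using hx), zero_smul]

/-- The matrix in the list that represents a given element of the group. -/
def code (g : linearValentiner) : {A // A ∈ elements} :=
  ⟨(exists_mem_elements g.2).choose, (exists_mem_elements g.2).choose_spec.1⟩

theorem ev_code (g : linearValentiner) :
    (code g).1.ev = ((g : GL (Fin 3) ℂ) : Matrix (Fin 3) (Fin 3) ℂ) :=
  (exists_mem_elements g.2).choose_spec.2.symm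

theorem code_bijective : Function.Bijective code := by
  constructor
  · intro g h e
    apply Subtype.ext
    apply Units.ext
    rw [← ev_code, ← ev_code, e]
  · rintro ⟨A, hA⟩
    obtain ⟨g, hg, e⟩ := represents_of_mem_elements hA
    refine ⟨⟨g, hg⟩, Subtype.ext (Mat.ev_injective ?_)⟩
    rw [ev_code, ← e]

instance : Finite linearValentiner :=
  have : Finite {A // A ∈ elements} := List.finite_toSet elements
  Finite.of_injective code code_bijective.1

instance : Fintype linearValentiner := Fintype.ofFinite _

theorem sum_code {M : Type*} [AddCommMonoid M] (F : Mat → M) :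
    ∑ g : linearValentiner, F (code g).1 = (elements.map F).sum := by
  refine Eq.trans ?_ (List.sum_toFinset F elements_nodup)
  refine Finset.sum_bij (fun g _ => (code g).1) (fun g _ => List.mem_toFinset.mpr (code g).2)
    (fun g _ h _ e => code_bijective.1 (Subtype.ext e)) (fun A hA => ?_) fun _ _ => rfl
  obtain ⟨g, hg⟩ := code_bijective.2 ⟨A, List.mem_toFinset.mp hA⟩
  exact ⟨g, Finset.mem_univ g, by rw [hg]⟩

theorem card_linearValentiner : Fintype.card linearValentiner = 1080 := by
  have h := sum_code (M := ℕ) fun _ => 1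
  rw [Finset.sum_const, smul_eq_mul, mul_one, List.map_const', List.sum_replicate, length_elements,
    smul_eq_mul, mul_one] at h
  exact h

theorem sum_trace {M : Type*} [AddCommMonoid M] (F : ℂ → M) :
    ∑ g : linearValentiner, F (((g : GL (Fin 3) ℂ) : Matrix (Fin 3) (Fin 3) ℂ)).trace =
      (traceTable.map fun p => p.2 • F (p.1.ev / 2)).sum := by
  have h₁ := sum_elements_tr fun x => F (x.ev / 2)
  have h₂ := sum_code fun A => F (A.tr.ev / 2)
  refine Eq.trans ?_ (h₂.trans h₁)
  refine Finset.sum_congr rfl fun g _ => ?_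
  rw [← Mat.trace_ev, ev_code]

/-! ### Molien's formula -/

section MolienFormula

variable {n : ℕ}

/-- Substitution reverses products; this is why `homogeneousRep` substitutes the inverse matrix. -/
theorem linSubst_mul (A B : Matrix (Fin n) (Fin n) ℂ) (F : MvPolynomial (Fin n) ℂ) :
    linSubst (A * B) F = linSubst B (linSubst A F) := by
  have : linSubst (A * B) = (linSubst B).comp (linSubst A) := by
    refine MvPolynomial.algHom_ext fun i => ?_
    simp only [linSubst, MvPolynomial.aeval_X, AlgHom.comp_apply, map_sum, map_mul,
      MvPolynomial.algHom_C, MvPolynomial.algebraMap_eq, Matrix.mul_apply, Finset.sum_mul,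
      Finset.mul_sum, mul_assoc]
    exact Finset.sum_comm
  rw [this, AlgHom.comp_apply]

theorem linSubst_diagonal (c : Fin n → ℂ) (i : Fin n) :
    linSubst (Matrix.diagonal c) (MvPolynomial.X i) = c i • MvPolynomial.X i := by
  simp [linSubst, Matrix.diagonal_apply, MvPolynomial.smul_eq_C_mul, apply_ite MvPolynomial.C]

theorem linSubst_one (F : MvPolynomial (Fin n) ℂ) : linSubst 1 F = F := by
  have : linSubst (1 : Matrix (Fin n) (Fin n) ℂ) = AlgHom.id ℂ _ := by
    refine MvPolynomial.algHom_ext fun i => ?_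
    rw [← Matrix.diagonal_one, linSubst_diagonal]
    simp
  rw [this, AlgHom.id_apply]

theorem isHomogeneous_linSubst (A : Matrix (Fin n) (Fin n) ℂ) {m : ℕ}
    {F : MvPolynomial (Fin n) ℂ} (hF : F.IsHomogeneous m) : (linSubst A F).IsHomogeneous m := by
  rw [← one_mul m]
  refine hF.aeval _ fun i => MvPolynomial.IsHomogeneous.sum _ _ _ fun j _ => ?_
  simpa using (MvPolynomial.isHomogeneous_C _ (A i j)).mul (MvPolynomial.isHomogeneous_X ℂ j)

/-- The representation of `GL n` on homogeneous polynomials of degree `m`. -/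
def homogeneousRep (n m : ℕ) :
    Representation ℂ (GL (Fin n) ℂ) (MvPolynomial.homogeneousSubmodule (Fin n) ℂ m) where
  toFun T := (linSubst ((T⁻¹ : GL (Fin n) ℂ) : Matrix (Fin n) (Fin n) ℂ)).toLinearMap.restrict
    fun _ hF => isHomogeneous_linSubst _ hF
  map_one' := LinearMap.ext fun F => Subtype.ext <| by
    change linSubst ((1⁻¹ : GL (Fin n) ℂ) : Matrix (Fin n) (Fin n) ℂ) F.1 = F.1
    rw [inv_one, Units.val_one, linSubst_one]
  map_mul' S T := LinearMap.ext fun F => Subtype.ext <| by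
    change linSubst (((S * T)⁻¹ : GL (Fin n) ℂ) : Matrix (Fin n) (Fin n) ℂ) F.1 =
      linSubst ((S⁻¹ : GL (Fin n) ℂ) : Matrix (Fin n) (Fin n) ℂ)
        (linSubst ((T⁻¹ : GL (Fin n) ℂ) : Matrix (Fin n) (Fin n) ℂ) F.1)
    rw [mul_inv_rev, Units.val_mul, linSubst_mul]

theorem coe_homogeneousRep_apply {m : ℕ} (T : GL (Fin n) ℂ)
    (F : MvPolynomial.homogeneousSubmodule (Fin n) ℂ m) :
    (homogeneousRep n m T F : MvPolynomial (Fin n) ℂ) =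
      linSubst ((T⁻¹ : GL (Fin n) ℂ) : Matrix (Fin n) (Fin n) ℂ) F := rfl

theorem linSubst_diagonal_monomial (c : Fin n → ℂ) (d : Fin n →₀ ℕ) :
    linSubst (Matrix.diagonal c) (MvPolynomial.monomial d 1) =
      (∏ i, c i ^ d i) • MvPolynomial.monomial d 1 := by
  have h : (MvPolynomial.monomial d (1 : ℂ)) = ∏ i, MvPolynomial.X i ^ d i := by
    rw [MvPolynomial.monomial_eq, MvPolynomial.C_1, one_mul,
      Finsupp.prod_fintype _ _ fun i => pow_zero _]
  rw [h, map_prod]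
  simp only [map_pow, linSubst_diagonal, smul_pow]
  rw [Finset.prod_smul]

instance (m : ℕ) : Module.Finite ℂ (MvPolynomial.homogeneousSubmodule (Fin n) ℂ m) :=
  Module.Finite.iff_fg.mpr (MvPolynomial.homogeneousSubmodule_fg _ _ m)

/-- The monomial basis of the space of homogeneous polynomials. -/
def monomialBasis (n m : ℕ) : Module.Basis (Finset.univ.finsuppAntidiag m : Finset (Fin n →₀ ℕ)) ℂ
    (MvPolynomial.homogeneousSubmodule (Fin n) ℂ m) :=
  ((MvPolynomial.basisRestrictSupport ℂ {d : Fin n →₀ ℕ | d.degree = m}).map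
    (LinearEquiv.ofEq _ _
      (MvPolynomial.homogeneousSubmodule_eq_finsupp_supported (Fin n) ℂ m).symm)).reindex
    (Equiv.subtypeEquivRight fun d => by
      simp [Finsupp.degree_eq_sum])

theorem coe_monomialBasis {m : ℕ} (d : (Finset.univ.finsuppAntidiag m : Finset (Fin n →₀ ℕ))) :
    (monomialBasis n m d : MvPolynomial (Fin n) ℂ) = MvPolynomial.monomial d.1 1 := by
  have h : monomialBasis n m d = ⟨MvPolynomial.monomial d.1 1, MvPolynomial.isHomogeneous_monomial _
      (by rw [Finsupp.degree_eq_sum]; exact (Finset.mem_finsuppAntidiag.mp d.2).1)⟩ := by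
    rw [Module.Basis.apply_eq_iff]
    ext e
    change MvPolynomial.coeff e.1 (MvPolynomial.monomial d.1 (1 : ℂ)) = _
    rw [MvPolynomial.coeff_monomial, Finsupp.single_apply]
    simp only [Subtype.ext_iff]
  rw [h]

/-- Monomials are eigenvectors of a diagonal substitution, so the trace is the complete homogeneous
symmetric polynomial of degree m in the diagonal entries. -/
theorem character_homogeneousRep_of_diagonal {m : ℕ} {T : GL (Fin n) ℂ} {c : Fin n → ℂ}
    (h : ((T⁻¹ : GL (Fin n) ℂ) : Matrix (Fin n) (Fin n) ℂ) = Matrix.diagonal c) :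
    (homogeneousRep n m).character T =
      PowerSeries.coeff m (∏ i, PowerSeries.mk fun k => c i ^ k) := by
  rw [Representation.character, LinearMap.trace_eq_matrix_trace ℂ (monomialBasis n m),
    Matrix.trace, PowerSeries.coeff_prod]
  refine Eq.trans (Fintype.sum_congr _ _ fun d => ?_)
    (Finset.sum_coe_sort (Finset.univ.finsuppAntidiag m)
      fun d : Fin n →₀ ℕ => ∏ i, PowerSeries.coeff (d i) (PowerSeries.mk fun k => c i ^ k))
  have : homogeneousRep n m T (monomialBasis n m d) = (∏ i, c i ^ d.1 i) • monomialBasis n m d := by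
    apply Subtype.ext
    rw [coe_homogeneousRep_apply, h, coe_monomialBasis, linSubst_diagonal_monomial,
      Submodule.coe_smul, coe_monomialBasis]
  rw [Matrix.diag_apply, LinearMap.toMatrix_apply, this]
  simp

theorem mk_pow_mul_one_sub (a : ℂ) :
    (PowerSeries.mk fun k => a ^ k) * (1 - PowerSeries.C a * PowerSeries.X) = 1 := by
  ext k
  cases k with
  | zero => simp
  | succ k =>
    rw [mul_sub, mul_one, mul_left_comm, map_sub, PowerSeries.coeff_C_mul,
      PowerSeries.coeff_succ_mul_X]
    simp [PowerSeries.coeff_one, pow_succ']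

/-- A matrix of finite order over the complex numbers is diagonalizable. -/
theorem exists_conj_diagonal_of_isOfFinOrder {T : GL (Fin n) ℂ} (hT : IsOfFinOrder T) :
    ∃ (U D : GL (Fin n) ℂ) (c : Fin n → ℂ), T = U * D * U⁻¹ ∧
      (D : Matrix (Fin n) (Fin n) ℂ) = Matrix.diagonal c := by
  obtain ⟨k, hk, hTk⟩ := isOfFinOrder_iff_pow_eq_one.mp hT
  set f : Module.End ℂ (Fin n → ℂ) := Matrix.toLin' (T : Matrix (Fin n) (Fin n) ℂ) with hf
  have hfk : f ^ k = 1 := by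
    rw [hf, ← Matrix.toLin'_pow, ← Units.val_pow_eq_pow_val, hTk, Units.val_one, Matrix.toLin'_one]
    rfl
  -- The polynomial X^k - 1 annihilates f and is separable in characteristic zero.
  have hss : f.IsSemisimple := by
    refine Module.End.isSemisimple_of_squarefree_aeval_eq_zero
      (p := Polynomial.X ^ k - Polynomial.C 1) ?_ (by simp [hfk])
    exact (Polynomial.separable_X_pow_sub_C (1 : ℂ) (by exact_mod_cast hk.ne') one_ne_zero).squarefree
  have hint : DirectSum.IsInternal f.eigenspace :=
    DirectSum.isInternal_submodule_of_iSupIndep_of_iSup_eq_top f.eigenspaces_iSupIndep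
      hss.iSup_eigenspace_eq_top
  let b₀ := hint.collectedBasis fun μ => Module.finBasis ℂ (f.eigenspace μ)
  have : Fintype (Σ μ : ℂ, Fin (Module.finrank ℂ (f.eigenspace μ))) :=
    FiniteDimensional.fintypeBasisIndex b₀
  have hcard : Fintype.card (Σ μ : ℂ, Fin (Module.finrank ℂ (f.eigenspace μ))) = n := by
    rw [← Module.finrank_eq_card_basis b₀, Module.finrank_fin_fun]
  let e := Fintype.equivFinOfCardEq hcard
  let b := b₀.reindex e
  let c : Fin n → ℂ := fun i => (e.symm i).1
  have hb : ∀ i, f (b i) = c i • b i := by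
    intro i
    have := hint.collectedBasis_mem (fun μ => Module.finBasis ℂ (f.eigenspace μ)) (e.symm i)
    rw [Module.End.mem_eigenspace_iff] at this
    simpa [b, c, b₀] using this
  let M : Matrix (Fin n) (Fin n) ℂ := (Pi.basisFun ℂ (Fin n)).toMatrix b
  let N : Matrix (Fin n) (Fin n) ℂ := b.toMatrix (Pi.basisFun ℂ (Fin n))
  have hMN : M * N = 1 := Module.Basis.toMatrix_mul_toMatrix_flip _ _
  have hNM : N * M = 1 := Module.Basis.toMatrix_mul_toMatrix_flip _ _
  let U : GL (Fin n) ℂ := ⟨M, N, hMN, hNM⟩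
  have hTM : (T : Matrix (Fin n) (Fin n) ℂ) * M = M * Matrix.diagonal c := by
    ext i j
    have hM : ∀ i j, M i j = b j i := fun i j => by
      simp only [M, Module.Basis.toMatrix_apply, Pi.basisFun_repr]
    have hj := congrFun (hb j) i
    rw [Matrix.mul_diagonal, Matrix.mul_apply]
    simp only [hM]
    rw [mul_comm]
    exact hj
  refine ⟨U, U⁻¹ * T * U, c, by group, ?_⟩
  change N * (T : Matrix (Fin n) (Fin n) ℂ) * M = _
  rw [mul_assoc, hTM, ← mul_assoc, hNM, one_mul]

/-- The generating function of the characters of a matrix of finite order and determinant one in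
dimension three. -/
theorem mk_character_mul_eq_one {T : GL (Fin 3) ℂ} (hT : IsOfFinOrder T)
    (hdet : (T : Matrix (Fin 3) (Fin 3) ℂ).det = 1) {a b : ℂ}
    (ha : (T : Matrix (Fin 3) (Fin 3) ℂ).trace = a)
    (hb : ((T⁻¹ : GL (Fin 3) ℂ) : Matrix (Fin 3) (Fin 3) ℂ).trace = b) :
    (PowerSeries.mk fun m => (homogeneousRep 3 m).character T) *
      (1 - PowerSeries.C b * PowerSeries.X + PowerSeries.C a * PowerSeries.X ^ 2
        - PowerSeries.X ^ 3) = 1 := by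
  -- The inverse of T is diagonalized, because T acts on polynomials through it.
  obtain ⟨U, D, c, hU, hD⟩ := exists_conj_diagonal_of_isOfFinOrder hT.inv
  have hT' : T = U * D⁻¹ * U⁻¹ := by rw [← inv_inv T, hU]; group
  have hchar : ∀ m, (homogeneousRep 3 m).character T =
      PowerSeries.coeff m (∏ i, PowerSeries.mk fun k => c i ^ k) := fun m => by
    rw [hT', Representation.char_conj,
      character_homogeneousRep_of_diagonal (c := c) (by rw [inv_inv, hD])]
  have hdetD : c 0 * c 1 * c 2 = 1 := by
    have h : ((T⁻¹ : GL (Fin 3) ℂ) : Matrix (Fin 3) (Fin 3) ℂ).det = 1 := by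
      rw [Matrix.coe_units_inv, Matrix.det_nonsing_inv, hdet, Ring.inverse_one]
    rw [hU, Units.val_mul, Units.val_mul, Matrix.det_mul, mul_comm, ← Matrix.det_mul, ← mul_assoc,
      ← Units.val_mul, inv_mul_cancel, Units.val_one, one_mul, hD,
      Matrix.det_diagonal, Fin.prod_univ_three] at h
    exact h
  have htr : ∀ S : GL (Fin 3) ℂ, ((U * S * U⁻¹ : GL (Fin 3) ℂ) : Matrix (Fin 3) (Fin 3) ℂ).trace =
      (S : Matrix (Fin 3) (Fin 3) ℂ).trace := fun S => by
    rw [Units.val_mul, Matrix.trace_mul_comm, ← Units.val_mul, inv_mul_cancel_left]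
  have hb' : b = c 0 + c 1 + c 2 := by
    rw [← hb, hU, htr, hD, Matrix.trace_diagonal, Fin.sum_univ_three]
  -- As the product of the eigenvalues is one, the inverse of each is the product of the other two;
  -- thus the second elementary symmetric function of the eigenvalues of T⁻¹ is the trace of T.
  have hDinv : ((D⁻¹ : GL (Fin 3) ℂ) : Matrix (Fin 3) (Fin 3) ℂ) =
      Matrix.diagonal ![c 1 * c 2, c 0 * c 2, c 0 * c 1] := by
    rw [Units.inv_eq_of_mul_eq_one_right (u := D)]
    rw [hD, Matrix.diagonal_mul_diagonal, ← Matrix.diagonal_one]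
    congr 1
    ext i
    fin_cases i
    · simp; linear_combination hdetD
    · simp; linear_combination hdetD
    · simp; linear_combination hdetD
  have ha' : a = c 1 * c 2 + c 0 * c 2 + c 0 * c 1 := by
    rw [← ha, hT', htr, hDinv, Matrix.trace_diagonal, Fin.sum_univ_three]
    simp
  have hmk : (PowerSeries.mk fun m => (homogeneousRep 3 m).character T) =
      ∏ i, PowerSeries.mk fun k => c i ^ k := by
    ext m
    rw [PowerSeries.coeff_mk, hchar]
  have hfac : (1 - PowerSeries.C b * PowerSeries.X + PowerSeries.C a * PowerSeries.X ^ 2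
        - PowerSeries.X ^ 3 : PowerSeries ℂ) = ∏ i, (1 - PowerSeries.C (c i) * PowerSeries.X) := by
    have hC := congrArg (PowerSeries.C (R := ℂ)) hdetD
    rw [map_mul, map_mul, map_one] at hC
    rw [ha', hb', Fin.prod_univ_three]
    simp only [map_add, map_mul]
    linear_combination PowerSeries.X ^ 3 * hC
  rw [hmk, hfac, ← Finset.prod_mul_distrib]
  simp only [mk_pow_mul_one_sub, Finset.prod_const_one]

/-- Molien's formula, coefficientwise. -/
theorem sum_character_eq (G : Subgroup (GL (Fin n) ℂ)) [Fintype G] (m : ℕ) :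
    ∑ g : G, (homogeneousRep n m).character (g : GL (Fin n) ℂ) =
      Fintype.card G * (Module.finrank ℂ (homogeneousInvariants G m) : ℂ) := by
  have hcard : (Nat.card G : ℂ) ≠ 0 := Nat.cast_ne_zero.mpr Nat.card_pos.ne'
  have : Invertible (Nat.card G : ℂ) := invertibleOfNonzero hcard
  let r : Representation ℂ G (MvPolynomial.homogeneousSubmodule (Fin n) ℂ m) :=
    (homogeneousRep n m).comp G.subtype
  have h := r.card_inv_mul_sum_char_eq_finrank
  have hinv : Module.finrank ℂ r.invariants = Module.finrank ℂ (homogeneousInvariants G m) := by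
    refine LinearEquiv.finrank_eq
      { toFun := fun F => ⟨F.1.1, F.1.2, fun T hT => congrArg Subtype.val (F.2 ⟨T, hT⟩)⟩
        invFun := fun F => ⟨⟨F.1, F.2.1⟩, fun g => Subtype.ext (F.2.2 g g.2)⟩
        map_add' := fun _ _ => rfl
        map_smul' := fun _ _ => rfl
        left_inv := fun _ => rfl
        right_inv := fun _ => rfl }
  rw [hinv, inv_mul_eq_iff_eq_mul₀ hcard, Nat.card_eq_fintype_card] at h
  exact h

end MolienFormula

/-! ### The sum over the group -/

/-- The denominator of the Molien series, with one factor for each basic invariant. -/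
def molienDenominator (K : Type*) [Field K] : PowerSeries K :=
  (1 - PowerSeries.X ^ 6) * (1 - PowerSeries.X ^ 12) * (1 - PowerSeries.X ^ 30)

/-- The power series `1 / det (1 - t g⁻¹)` for a special unitary matrix `g` with trace `a`. -/
def charSeries (a : ℂ) : PowerSeries ℂ :=
  (1 - PowerSeries.C (star a) * PowerSeries.X + PowerSeries.C a * PowerSeries.X ^ 2
    - PowerSeries.X ^ 3)⁻¹

theorem charSeries_mul (a : ℂ) :
    charSeries a * (1 - PowerSeries.C (star a) * PowerSeries.X
      + PowerSeries.C a * PowerSeries.X ^ 2 - PowerSeries.X ^ 3) = 1 :=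
  PowerSeries.inv_mul_cancel _ (by simp)

/-- Multiplying the group element by ρ amounts to replacing x by a primitive cube root of unity
times x. The sum over the three multiples is therefore a function of x³, with denominator the
product of the three cubics. -/
theorem sum_three_mul {A : Type*} [CommRing A] {s r x f g h : A} (hr : r ^ 2 = -1 - r)
    (hf : f * (1 - s * x + s * x ^ 2 - x ^ 3) = 1)
    (hg : g * (1 - s * (-1 - r) * x + s * r * x ^ 2 - x ^ 3) = 1)
    (hh : h * (1 - s * r * x + s * (-1 - r) * x ^ 2 - x ^ 3) = 1) :
    (f + g + h) * ((1 - x ^ 3) * ((1 - x ^ 3) ^ 2 + (3 * s ^ 2 - s ^ 3) * x ^ 3)) =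
      3 * ((1 - x ^ 3) ^ 2 + s ^ 2 * x ^ 3) := by
  set d₀ := 1 - s * x + s * x ^ 2 - x ^ 3 with h₀
  set d₁ := 1 - s * (-1 - r) * x + s * r * x ^ 2 - x ^ 3 with h₁
  set d₂ := 1 - s * r * x + s * (-1 - r) * x ^ 2 - x ^ 3 with h₂
  have e₁₂ : d₁ * d₂ = (1 - x ^ 3) ^ 2 + (1 - x ^ 3) * (s * x - s * x ^ 2)
      + s ^ 2 * (x ^ 2 + x ^ 3 + x ^ 4) := by
    rw [h₁, h₂]
    linear_combination (-s ^ 2 * x ^ 2 - s ^ 2 * x ^ 4 - 2 * s ^ 2 * x ^ 3) * hr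
  have e₀ : d₀ * (d₁ * d₂) =
      (1 - x ^ 3) * ((1 - x ^ 3) ^ 2 + (3 * s ^ 2 - s ^ 3) * x ^ 3) := by
    rw [e₁₂, h₀]
    ring
  have e : d₁ * d₂ + d₀ * d₂ + d₀ * d₁ = 3 * ((1 - x ^ 3) ^ 2 + s ^ 2 * x ^ 3) := by
    rw [e₁₂, h₀, h₁, h₂]
    ring
  rw [← e₀, ← e]
  linear_combination d₁ * d₂ * hf + d₀ * d₂ * hg + d₀ * d₁ * hh

theorem charSeries_sum_three {s : ℂ} (hs : star s = s) :
    (charSeries s + charSeries (s * rho) + charSeries (s * (-1 - rho))) *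
      ((1 - PowerSeries.X ^ 3) * ((1 - PowerSeries.X ^ 3) ^ 2 +
        (3 * PowerSeries.C s ^ 2 - PowerSeries.C s ^ 3) * PowerSeries.X ^ 3)) =
      3 * ((1 - PowerSeries.X ^ 3) ^ 2 + PowerSeries.C s ^ 2 * PowerSeries.X ^ 3) := by
  have hr := congrArg (PowerSeries.C (R := ℂ)) rho_sq
  have h₀ := charSeries_mul s
  have h₁ := charSeries_mul (s * rho)
  have h₂ := charSeries_mul (s * (-1 - rho))
  rw [star_mul', star_rho, hs] at h₁
  rw [star_mul', star_sub, star_rho, hs, star_neg, star_one, sub_sub_cancel] at h₂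
  rw [hs] at h₀
  simp only [map_mul, map_sub, map_neg, map_one, map_pow] at hr h₀ h₁ h₂
  exact sum_three_mul hr h₀ h₁ h₂

/-- Here y stands for t³. For s = 3, -1, 1 the denominators are (1 - y)³, (1 - y)(1 + y)² and (1 -
y)(1 + y²). For s = τ and 1 - τ they are (1 - y) times conjugate quadratics whose product is 1 + y +
y² + y³ + y⁴, so τ cancels from the sum of these two classes, which have equal size. -/
theorem class_sum_identity {A : Type*} [CommRing A] {y t f₀ f₃ f₂ f₁ g g' : A}
    (ht : t ^ 2 = t + 1)
    (h₀ : f₀ * (1 - y) = 1)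
    (h₃ : f₃ * ((1 - y) * ((1 - y) ^ 2 + (3 * 3 ^ 2 - 3 ^ 3) * y)) =
      3 * ((1 - y) ^ 2 + 3 ^ 2 * y))
    (h₂ : f₂ * ((1 - y) * ((1 - y) ^ 2 + (3 * (-1) ^ 2 - (-1) ^ 3) * y)) =
      3 * ((1 - y) ^ 2 + (-1) ^ 2 * y))
    (h₁ : f₁ * ((1 - y) * ((1 - y) ^ 2 + (3 * 1 ^ 2 - 1 ^ 3) * y)) =
      3 * ((1 - y) ^ 2 + 1 ^ 2 * y))
    (h : g * ((1 - y) * ((1 - y) ^ 2 + (3 * t ^ 2 - t ^ 3) * y)) = 3 * ((1 - y) ^ 2 + t ^ 2 * y))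
    (h' : g' * ((1 - y) * ((1 - y) ^ 2 + (3 * (1 - t) ^ 2 - (1 - t) ^ 3) * y)) =
      3 * ((1 - y) ^ 2 + (1 - t) ^ 2 * y)) :
    (240 * f₀ + f₃ + 45 * f₂ + 90 * f₁ + 72 * g + 72 * g') *
      ((1 - y ^ 2) * (1 - y ^ 4) * (1 - y ^ 10)) = 1080 * (1 + y ^ 15) := by
  have ht3 : t ^ 3 = 2 * t + 1 := by linear_combination (t + 1) * ht
  have e : (1 + t * y + y ^ 2) * (1 + (1 - t) * y + y ^ 2) = 1 + y + y ^ 2 + y ^ 3 + y ^ 4 := by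
    linear_combination -y ^ 2 * ht
  have k : g * ((1 - y) * (1 + t * y + y ^ 2)) = 3 * (1 + (t - 1) * y + y ^ 2) := by
    linear_combination h + (3 * y - g * (1 - y) * 3 * y) * ht + g * (1 - y) * y * ht3
  have k' : g' * ((1 - y) * (1 + (1 - t) * y + y ^ 2)) = 3 * (1 - t * y + y ^ 2) := by
    linear_combination h' + 3 * y * ht - g' * (1 - y) * y * ht3
  have m : g * (1 - y ^ 5) = 3 * (1 + (t - 1) * y + y ^ 2) * (1 + (1 - t) * y + y ^ 2) := by
    linear_combination (1 + (1 - t) * y + y ^ 2) * k - g * (1 - y) * e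
  have m' : g' * (1 - y ^ 5) = 3 * (1 - t * y + y ^ 2) * (1 + t * y + y ^ 2) := by
    linear_combination (1 + t * y + y ^ 2) * k' - g' * (1 - y) * e
  have q : (g + g') * (1 - y ^ 5) = 3 * (2 * (1 + y ^ 2) ^ 2 - 3 * y ^ 2) := by
    linear_combination m + m' - 6 * y ^ 2 * ht
  have c₃ : f₃ * (1 - y) ^ 3 = 3 * (1 + 7 * y + y ^ 2) := by linear_combination h₃
  have c₂ : f₂ * ((1 - y) * (1 + y) ^ 2) = 3 * (1 - y + y ^ 2) := by linear_combination h₂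
  have c₁ : f₁ * ((1 - y) * (1 + y ^ 2)) = 3 * (1 - y + y ^ 2) := by linear_combination h₁
  have p₀ : (1 - y ^ 2) * (1 - y ^ 4) = (1 - y) ^ 2 * (1 + y) ^ 2 * (1 + y ^ 2) := by ring
  have p₁ : (1 - y ^ 10) = (1 - y) * (1 + y + y ^ 2 + y ^ 3 + y ^ 4) * (1 + y ^ 5) := by ring
  rw [p₀, p₁]
  -- Each coefficient is the multiplicity times the common denominator divided by the denominator of
  -- that class.
  linear_combination
    240 * (1 - y) ^ 2 * (1 + y) ^ 2 * (1 + y ^ 2) * (1 + y + y ^ 2 + y ^ 3 + y ^ 4) * (1 + y ^ 5) * h₀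
    + (1 + y) ^ 2 * (1 + y ^ 2) * (1 + y + y ^ 2 + y ^ 3 + y ^ 4) * (1 + y ^ 5) * c₃
    + 45 * (1 - y) ^ 2 * (1 + y ^ 2) * (1 + y + y ^ 2 + y ^ 3 + y ^ 4) * (1 + y ^ 5) * c₂
    + 90 * (1 - y) ^ 2 * (1 + y) ^ 2 * (1 + y + y ^ 2 + y ^ 3 + y ^ 4) * (1 + y ^ 5) * c₁
    + 72 * (1 - y) ^ 2 * (1 + y) ^ 2 * (1 + y ^ 2) * (1 + y ^ 5) * q

theorem traceTable_map_ev : (traceTable.map fun p => (p.1.ev / 2, p.2)) =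
    [(0, 240), (3, 1), (3 * rho, 1), (3 * (-1 - rho), 1),
      (-1, 45), (-1 * rho, 45), (-1 * (-1 - rho), 45),
      (1, 90), (1 * rho, 90), (1 * (-1 - rho), 90),
      (tau, 72), (tau * rho, 72), (tau * (-1 - rho), 72),
      (1 - tau, 72), ((1 - tau) * rho, 72), ((1 - tau) * (-1 - rho), 72)] := by
  simp only [traceTable, List.map_cons, List.map_nil, Quad.ev]
  push_cast
  simp only [List.cons.injEq, Prod.mk.injEq, and_true]
  and_intros <;> ring

theorem sum_charSeries_mul :
    (traceTable.map fun p => p.2 • charSeries (p.1.ev / 2)).sum * molienDenominator ℂ =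
      1080 * (1 + PowerSeries.X ^ 45) := by
  have ht := congrArg (PowerSeries.C (R := ℂ)) tau_sq
  have h₀ := charSeries_mul 0
  have h₃ := charSeries_sum_three (s := 3) (by simp)
  have h₂ := charSeries_sum_three (s := -1) (by simp)
  have h₁ := charSeries_sum_three (s := 1) (by simp)
  have h := charSeries_sum_three star_tau
  have h' := charSeries_sum_three (s := 1 - tau) (by rw [star_sub, star_tau, star_one])
  have c3 : PowerSeries.C (3 : ℂ) = 3 := map_ofNat _ 3
  simp only [map_add, map_sub, map_neg, map_one, map_pow, map_zero, star_zero, zero_mul, sub_zero,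
    add_zero, c3] at ht h₀ h₃ h₂ h₁ h h'
  have key := class_sum_identity ht h₀ h₃ h₂ h₁ h h'
  have hden : molienDenominator ℂ = (1 - (PowerSeries.X ^ 3) ^ 2) * (1 - (PowerSeries.X ^ 3) ^ 4) *
      (1 - (PowerSeries.X ^ 3) ^ 10) := by
    rw [molienDenominator]; ring
  rw [hden, show (PowerSeries.X : PowerSeries ℂ) ^ 45 = (PowerSeries.X ^ 3) ^ 15 by ring, ← key]
  congr 1
  have hmap : (traceTable.map fun p => p.2 • charSeries (p.1.ev / 2)) =
      (traceTable.map fun p => (p.1.ev / 2, p.2)).map fun p => p.2 • charSeries p.1 := by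
    rw [List.map_map]; rfl
  rw [hmap, traceTable_map_ev]
  simp only [List.map_cons, List.map_nil, List.sum_cons, List.sum_nil, nsmul_eq_mul]
  push_cast
  simp only [one_mul]
  ring

/-! ### The special unitary lift -/

namespace Quad

/-- Complex conjugation. -/
def conj (x : Quad) : Quad := ⟨x.a - x.c, x.b - x.d, -x.c, -x.d⟩

theorem ev_conj (x : Quad) : x.conj.ev = star x.ev := by
  simp only [ev, conj, star_add, star_mul', star_rho, star_tau, Complex.star_def, map_intCast]
  push_cast
  ring

end Quad

namespace Mat

/-- The conjugate transpose. -/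
def adj (A : Mat) : Mat :=
  ⟨⟨A.x.x.conj, A.y.x.conj, A.z.x.conj⟩, ⟨A.x.y.conj, A.y.y.conj, A.z.y.conj⟩,
    ⟨A.x.z.conj, A.y.z.conj, A.z.z.conj⟩⟩

theorem ev_adj (A : Mat) : A.adj.ev = star A.ev := by
  ext i j
  fin_cases i <;> fin_cases j <;> simp [ev, adj, Quad.ev_conj]

theorem ev_mem_unitaryGroup {A : Mat} (h : A.mul A.adj = one.map .double) :
    A.ev ∈ Matrix.unitaryGroup (Fin 3) ℂ := by
  rw [Matrix.mem_unitaryGroup_iff, ← ev_adj, ← ev_eq_mul h, ev_one]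

end Mat

theorem mem_V3 {g : GL (Fin 3) ℂ} : g ∈ V3 ↔
    (g : Matrix (Fin 3) (Fin 3) ℂ) ∈ Matrix.specialUnitaryGroup (Fin 3) ℂ ∧
      Matrix.ProjGenLinGroup.mk g ∈ valentinerGroup := Iff.rfl

theorem valentinerGroup_eq_map :
    valentinerGroup = linearValentiner.map Matrix.ProjGenLinGroup.mk := by
  rw [linearValentiner, MonoidHom.map_closure, valentinerGroup, icosahedralGroup, tetrahedralGroup,
    ← Subgroup.closure_union, ← Subgroup.closure_union]
  congr 1
  simp only [Set.image_insert_eq, Set.image_singleton, Set.insert_union, Set.singleton_union]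

theorem linearValentiner_le_V3 : linearValentiner ≤ V3 := by
  have hmk : ∀ g ∈ linearValentiner, Matrix.ProjGenLinGroup.mk g ∈ valentinerGroup := fun g hg => by
    rw [valentinerGroup_eq_map]
    exact ⟨g, hg, rfl⟩
  rw [linearValentiner, Subgroup.closure_le]
  intro g hg
  refine ⟨Matrix.mem_specialUnitaryGroup_iff.mpr ?_, hmk g (Subgroup.subset_closure hg)⟩
  simp only [Set.mem_insert_iff, Set.mem_singleton_iff] at hg
  rcases hg with rfl | rfl | rfl | rfl | rfl
  · exact ⟨coe_Z1 ▸ Mat.ev_mem_unitaryGroup (by decide +kernel), det_matZ1⟩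
  · exact ⟨coe_Z2 ▸ Mat.ev_mem_unitaryGroup (by decide +kernel), det_matZ2⟩
  · exact ⟨coe_T1 ▸ Mat.ev_mem_unitaryGroup (by decide +kernel), det_matT1⟩
  · exact ⟨coe_P ▸ Mat.ev_mem_unitaryGroup (by decide +kernel), det_matP⟩
  · exact ⟨coe_Q ▸ Mat.ev_mem_unitaryGroup (by decide +kernel), det_matQ⟩

/-- Two lifts of one projective class differ by a scalar u; equal determinants force u³ = 1, and the
scalar matrix ρ is `R`, already in the group. -/
theorem V3_eq_linearValentiner : V3 = linearValentiner := by
  refine le_antisymm (fun g hg => ?_) linearValentiner_le_V3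
  obtain ⟨hsu, hmk⟩ := mem_V3.mp hg
  rw [valentinerGroup_eq_map] at hmk
  obtain ⟨h, hh, e⟩ := hmk
  obtain ⟨u, rfl⟩ := Matrix.ProjGenLinGroup.mk_eq_mk_iff.mp e
  have hdet := (Matrix.mem_specialUnitaryGroup_iff.mp hsu).2
  have hdeth := (Matrix.mem_specialUnitaryGroup_iff.mp (linearValentiner_le_V3 hh).1).2
  have hscal : ((Matrix.GeneralLinearGroup.scalar (Fin 3) u : GL (Fin 3) ℂ) :
      Matrix (Fin 3) (Fin 3) ℂ) = (u : ℂ) • 1 := by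
    ext i j
    simp [Matrix.smul_apply, Matrix.one_apply, Matrix.diagonal_apply]
  have hu : (u : ℂ) ^ 3 = 1 := by
    rw [Units.val_mul, Matrix.det_mul, hdeth, one_mul, hscal, Matrix.det_smul, Matrix.det_one,
      mul_one, Fintype.card_fin] at hdet
    exact hdet
  have hfac : ((u : ℂ) - 1) * (((u : ℂ) - rho) * ((u : ℂ) - rho ^ 2)) = 0 := by
    linear_combination hu - (u ^ 2 - u : ℂ) * rho_sq + (u - 1 : ℂ) * rho_pow_three
  have hpow : ∀ k : ℕ, (u : ℂ) = rho ^ k →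
      Matrix.GeneralLinearGroup.scalar (Fin 3) u ∈ linearValentiner := by
    intro k hk
    have : Matrix.GeneralLinearGroup.scalar (Fin 3) u = R ^ k := Units.ext <| by
      rw [hscal, Units.val_pow_eq_pow_val, coe_R_eq_smul, smul_pow, one_pow, hk]
    rw [this]
    exact pow_mem R_mem k
  refine mul_mem hh ?_
  rcases mul_eq_zero.mp hfac with h1 | h23
  · exact hpow 0 (by rw [pow_zero]; exact sub_eq_zero.mp h1)
  rcases mul_eq_zero.mp h23 with h2 | h3
  · exact hpow 1 (by rw [pow_one]; exact sub_eq_zero.mp h2)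
  · exact hpow 2 (sub_eq_zero.mp h3)

theorem natCard_V3 : Nat.card V3 = 1080 := by
  rw [V3_eq_linearValentiner, Nat.card_eq_fintype_card, card_linearValentiner]

/-! ### The Molien series of the special unitary lift -/

theorem trace_inv_of_mem_linearValentiner {g : GL (Fin 3) ℂ} (hg : g ∈ linearValentiner) :
    ((g⁻¹ : GL (Fin 3) ℂ) : Matrix (Fin 3) (Fin 3) ℂ).trace =
      star (g : Matrix (Fin 3) (Fin 3) ℂ).trace := by
  have hu := (Matrix.mem_specialUnitaryGroup_iff.mp (linearValentiner_le_V3 hg).1).1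
  rw [← Matrix.trace_conjTranspose, ← Matrix.star_eq_conjTranspose]
  congr 1
  exact (Units.eq_inv_of_mul_eq_one_right (Matrix.mem_unitaryGroup_iff'.mp hu)).symm

theorem mk_character_eq_charSeries {g : GL (Fin 3) ℂ} (hg : g ∈ linearValentiner) :
    (PowerSeries.mk fun m => (homogeneousRep 3 m).character g) =
      charSeries (g : Matrix (Fin 3) (Fin 3) ℂ).trace := by
  have hord : IsOfFinOrder g := by
    have := isOfFinOrder_of_finite (⟨g, hg⟩ : linearValentiner)
    exact linearValentiner.subtype.isOfFinOrder this
  have hdet := (Matrix.mem_specialUnitaryGroup_iff.mp (linearValentiner_le_V3 hg).1).2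
  have h := mk_character_mul_eq_one hord hdet rfl (trace_inv_of_mem_linearValentiner hg)
  have h' := charSeries_mul (g : Matrix (Fin 3) (Fin 3) ℂ).trace
  exact left_inv_eq_right_inv h ((mul_comm _ _).trans h')

theorem molienSeries_V3_mul : molienSeries V3 * molienDenominator ℚ = 1 + PowerSeries.X ^ 45 := by
  rw [V3_eq_linearValentiner]
  let φ : PowerSeries ℚ →+* PowerSeries ℂ := PowerSeries.map (algebraMap ℚ ℂ)
  have hφ : Function.Injective φ := PowerSeries.map_injective _ (algebraMap ℚ ℂ).injective
  have hsum : 1080 * φ (molienSeries linearValentiner) =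
      (traceTable.map fun p => p.2 • charSeries (p.1.ev / 2)).sum := by
    rw [← sum_trace charSeries]
    have : ∀ g : linearValentiner,
        charSeries ((g : GL (Fin 3) ℂ) : Matrix (Fin 3) (Fin 3) ℂ).trace =
          PowerSeries.mk fun m => (homogeneousRep 3 m).character (g : GL (Fin 3) ℂ) :=
      fun g => (mk_character_eq_charSeries g.2).symm
    simp only [this]
    ext m
    have h := sum_character_eq linearValentiner m
    rw [card_linearValentiner] at h
    have h1080 : (1080 : PowerSeries ℂ) = PowerSeries.C 1080 := (map_ofNat _ _).symm
    rw [map_sum, h1080, PowerSeries.coeff_C_mul]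
    simp only [PowerSeries.coeff_mk, h, φ, PowerSeries.coeff_map, molienSeries]
    simp
  apply hφ
  have h1080 : (1080 : PowerSeries ℂ) ≠ 0 := by
    have : (1080 : PowerSeries ℂ) = PowerSeries.C 1080 := (map_ofNat _ _).symm
    rw [this, Ne, map_eq_zero_iff _ PowerSeries.C_injective]
    norm_num
  apply mul_left_cancel₀ h1080
  rw [map_mul, ← mul_assoc, hsum]
  have hden : φ (molienDenominator ℚ) = molienDenominator ℂ := by
    simp [φ, molienDenominator]
  rw [hden, sum_charSeries_mul]
  simp [φ]

/-! ### The reflection group -/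

/-- All eigenvalues are ±1, and the rank condition says that exactly one of them differs from 1. -/
theorem det_of_isInvolutoryReflection {n : ℕ} {g : GL (Fin n) ℂ} (hg : IsInvolutoryReflection g) :
    (g : Matrix (Fin n) (Fin n) ℂ).det = -1 := by
  obtain ⟨U, D, c, rfl, hD⟩ := exists_conj_diagonal_of_isOfFinOrder
    (isOfFinOrder_iff_pow_eq_one.mpr ⟨2, two_pos, hg.1⟩)
  have hdet : ((U * D * U⁻¹ : GL (Fin n) ℂ) : Matrix (Fin n) (Fin n) ℂ).det = ∏ i, c i := by
    rw [Units.val_mul, Units.val_mul, Matrix.coe_units_inv, Matrix.det_conj U.isUnit, hD,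
      Matrix.det_diagonal]
  have hsq : ∀ i, c i ^ 2 = 1 := by
    have h : D ^ 2 = 1 := by
      have := hg.1
      rw [conj_pow] at this
      simpa using this
    have h' := congrArg (fun x : GL (Fin n) ℂ => (x : Matrix (Fin n) (Fin n) ℂ)) h
    simp only [Units.val_pow_eq_pow_val, hD, Matrix.diagonal_pow, Units.val_one,
      ← Matrix.diagonal_one] at h'
    intro i
    simpa using congrFun (Matrix.diagonal_injective h') i
  have hrank := hg.2
  have hsub : ((U * D * U⁻¹ : GL (Fin n) ℂ) : Matrix (Fin n) (Fin n) ℂ) - 1 =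
      U * (Matrix.diagonal (fun i => c i - 1)) * (U⁻¹ : GL (Fin n) ℂ) := by
    have : Matrix.diagonal (fun i => c i - 1) = (D : Matrix (Fin n) (Fin n) ℂ) - 1 := by
      rw [hD, ← Matrix.diagonal_one, Matrix.diagonal_sub]
    rw [this, mul_sub, sub_mul, mul_one, ← Units.val_mul U U⁻¹, mul_inv_cancel]
    simp
  have hdetU : ∀ V : GL (Fin n) ℂ, IsUnit (V : Matrix (Fin n) (Fin n) ℂ).det := fun V =>
    (Matrix.isUnit_iff_isUnit_det _).mp V.isUnit
  rw [hsub, Matrix.rank_mul_eq_left_of_isUnit_det _ _ (hdetU _),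
    Matrix.rank_mul_eq_right_of_isUnit_det _ _ (hdetU _), Matrix.rank_diagonal,
    Fintype.card_eq_one_iff] at hrank
  obtain ⟨⟨i, hi⟩, huniq⟩ := hrank
  rw [hdet, Finset.prod_eq_single i]
  · rcases eq_or_eq_neg_of_sq_eq_sq _ 1 ((hsq i).trans (one_pow 2).symm) with h | h
    · exact absurd (sub_eq_zero.mpr h) hi
    · exact h
  · intro j _ hj
    by_contra h
    exact hj (congrArg Subtype.val (huniq ⟨j, sub_ne_zero.mpr h⟩))
  · exact fun h => absurd (Finset.mem_univ i) h

theorem det_of_mem_linearValentiner {g : GL (Fin 3) ℂ} (hg : g ∈ linearValentiner) :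
    (g : Matrix (Fin 3) (Fin 3) ℂ).det = 1 :=
  (Matrix.mem_specialUnitaryGroup_iff.mp (linearValentiner_le_V3 hg).1).2

theorem unitary_of_mem_linearValentiner {g : GL (Fin 3) ℂ} (hg : g ∈ linearValentiner) :
    (g : Matrix (Fin 3) (Fin 3) ℂ) ∈ Matrix.unitaryGroup (Fin 3) ℂ :=
  (Matrix.mem_specialUnitaryGroup_iff.mp (linearValentiner_le_V3 hg).1).1

theorem mk_neg (g : GL (Fin 3) ℂ) :
    Matrix.ProjGenLinGroup.mk (-g) = Matrix.ProjGenLinGroup.mk g := by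
  rw [Matrix.ProjGenLinGroup.mk_eq_mk_iff]
  refine ⟨-1, Units.ext ?_⟩
  ext i j
  simp [Matrix.mul_apply, Matrix.diagonal_apply]

theorem neg_mem_linearValentiner_of_mem_reflections {g : GL (Fin 3) ℂ}
    (hg : g ∈ valentinerReflections) : -g ∈ linearValentiner := by
  obtain ⟨hu, hr, hmk⟩ := hg
  rw [← V3_eq_linearValentiner]
  refine ⟨Matrix.mem_specialUnitaryGroup_iff.mpr ⟨?_, ?_⟩, by rwa [mk_neg]⟩
  · rw [Matrix.mem_unitaryGroup_iff, Units.val_neg, star_neg, neg_mul_neg]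
    exact Matrix.mem_unitaryGroup_iff.mp hu
  · rw [Units.val_neg, Matrix.det_neg, det_of_isInvolutoryReflection hr, Fintype.card_fin]
    norm_num

theorem mem_or_neg_mem_of_mem_V6 {g : GL (Fin 3) ℂ} (hg : g ∈ V6) :
    g ∈ linearValentiner ∨ -g ∈ linearValentiner := by
  induction hg using Subgroup.closure_induction with
  | mem g hg => exact .inr (neg_mem_linearValentiner_of_mem_reflections hg)
  | one => exact .inl (one_mem _)
  | mul x y _ _ hx hy =>
    rcases hx with hx | hx <;> rcases hy with hy | hy
    · exact .inl (mul_mem hx hy)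
    · exact .inr (by simpa using mul_mem hx hy)
    · exact .inr (by simpa using mul_mem hx hy)
    · exact .inl (by simpa using mul_mem hx hy)
  | inv x _ hx =>
    rcases hx with hx | hx
    · exact .inl (inv_mem hx)
    · exact .inr (by simpa using inv_mem hx)

theorem Z1_mem : Z1 ∈ linearValentiner := Subgroup.subset_closure (by simp)

theorem Z2_mem : Z2 ∈ linearValentiner := Subgroup.subset_closure (by simp)

theorem T1_mem : T1 ∈ linearValentiner := Subgroup.subset_closure (by simp)

theorem P_mem : P ∈ linearValentiner := Subgroup.subset_closure (by simp)

theorem Q_mem : Q ∈ linearValentiner := Subgroup.subset_closure (by simp)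

theorem neg_Z1_mem_reflections : -Z1 ∈ valentinerReflections := by
  have hdiag : ((-Z1 : GL (Fin 3) ℂ) : Matrix (Fin 3) (Fin 3) ℂ) = Matrix.diagonal ![-1, 1, 1] := by
    change -matZ1 = _
    ext i j
    fin_cases i <;> fin_cases j <;> simp [matZ1]
  refine ⟨?_, ⟨Units.ext ?_, ?_⟩, ?_⟩
  · rw [Matrix.mem_unitaryGroup_iff, Units.val_neg, star_neg, neg_mul_neg]
    exact Matrix.mem_unitaryGroup_iff.mp (unitary_of_mem_linearValentiner Z1_mem)
  · rw [Units.val_pow_eq_pow_val, hdiag, Matrix.diagonal_pow, Units.val_one, ← Matrix.diagonal_one]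
    congr 1
    ext i
    fin_cases i <;> simp
  · rw [hdiag, ← Matrix.diagonal_one, Matrix.diagonal_sub, Matrix.rank_diagonal,
      Fintype.card_eq_one_iff]
    refine ⟨⟨0, by norm_num⟩, ?_⟩
    rintro ⟨j, hj⟩
    fin_cases j
    · rfl
    · exact absurd (by simp) hj
    · exact absurd (by simp) hj
  · rw [mk_neg]
    exact (linearValentiner_le_V3 Z1_mem).2

theorem conj_mem_reflections {w g : GL (Fin 3) ℂ} (hw : w ∈ linearValentiner)
    (hg : g ∈ valentinerReflections) : w * g * w⁻¹ ∈ valentinerReflections := by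
  obtain ⟨hu, hr, hmk⟩ := hg
  refine ⟨?_, ⟨?_, ?_⟩, ?_⟩
  · rw [Units.val_mul, Units.val_mul]
    exact mul_mem (mul_mem (unitary_of_mem_linearValentiner hw) hu)
      (unitary_of_mem_linearValentiner (inv_mem hw))
  · rw [conj_pow, hr.1]
    simp
  · have hsub : ((w * g * w⁻¹ : GL (Fin 3) ℂ) : Matrix (Fin 3) (Fin 3) ℂ) - 1 =
        w * ((g : Matrix (Fin 3) (Fin 3) ℂ) - 1) * (w⁻¹ : GL (Fin 3) ℂ) := by
      rw [mul_sub, sub_mul, mul_one, ← Units.val_mul w w⁻¹, mul_inv_cancel]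
      simp
    have hdet : ∀ V : GL (Fin 3) ℂ, IsUnit (V : Matrix (Fin 3) (Fin 3) ℂ).det := fun V =>
      (Matrix.isUnit_iff_isUnit_det _).mp V.isUnit
    rw [hsub, Matrix.rank_mul_eq_left_of_isUnit_det _ _ (hdet _),
      Matrix.rank_mul_eq_right_of_isUnit_det _ _ (hdet _), hr.2]
  · have h := (linearValentiner_le_V3 hw).2
    rw [map_mul, map_mul, map_inv]
    exact mul_mem (mul_mem h hmk) (inv_mem h)

theorem conj_mem_V6 {w g : GL (Fin 3) ℂ} (hw : w ∈ linearValentiner) (hg : g ∈ V6) :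
    w * g * w⁻¹ ∈ V6 := by
  have h : V6 ≤ V6.comap (MulAut.conj w).toMonoidHom := by
    rw [V6, Subgroup.closure_le]
    intro x hx
    exact Subgroup.subset_closure (conj_mem_reflections hw hx)
  exact h hg

theorem T1_mul_Z1 : T1 * Z1 * T1⁻¹ = Z2 := by
  rw [mul_inv_eq_iff_eq_mul]
  apply Units.ext
  change matT1 * matZ1 = matZ2 * matT1
  ext i j
  fin_cases i <;> fin_cases j <;> simp [matT1, matZ1, matZ2, Matrix.mul_apply, Fin.sum_univ_three]

theorem T1_mul_Z2 : T1 * Z2 * T1⁻¹ = Z1 * Z2 := by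
  rw [mul_inv_eq_iff_eq_mul]
  apply Units.ext
  change matT1 * matZ2 = matZ1 * matZ2 * matT1
  ext i j
  fin_cases i <;> fin_cases j <;> simp [matT1, matZ1, matZ2, Matrix.mul_apply, Fin.sum_univ_three]

/-- Conjugation by T₁ carries the reflection -Z₁ to -Z₂ and then to -Z₁Z₂, and (-Z₁)(-Z₂) = Z₁Z₂. -/
theorem neg_one_mem_V6 : (-1 : GL (Fin 3) ℂ) ∈ V6 := by
  have h₁ : -Z1 ∈ V6 := Subgroup.subset_closure neg_Z1_mem_reflections
  have h₂ : -Z2 ∈ V6 := by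
    have := conj_mem_V6 T1_mem h₁
    rwa [mul_neg, neg_mul, T1_mul_Z1] at this
  have h₃ : -(Z1 * Z2) ∈ V6 := by
    have := conj_mem_V6 T1_mem h₂
    rwa [mul_neg, neg_mul, T1_mul_Z2] at this
  have h := mul_mem (mul_mem h₁ h₂) (inv_mem h₃)
  rwa [neg_mul_neg, inv_neg, mul_neg, mul_inv_cancel] at h

theorem pow_eq_one_of_chain {l : List (GL (Fin 3) ℂ)} {w : List Mat}
    (hl : l.map (Units.coeHom (Matrix (Fin 3) (Fin 3) ℂ)) = w.map Mat.ev) {k : ℕ} {A : Mat}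
    (h : Mat.chain w = some A) (hA : Mat.chain (List.replicate k A) = some .one) :
    l.prod ^ k = 1 := by
  apply Units.ext
  have e : ((l.prod : GL (Fin 3) ℂ) : Matrix (Fin 3) (Fin 3) ℂ) = A.ev := by
    rw [Mat.ev_chain h, ← hl]
    exact map_list_prod (Units.coeHom (Matrix (Fin 3) (Fin 3) ℂ)) l
  rw [Units.val_pow_eq_pow_val, e, Units.val_one, ← Mat.ev_one, Mat.ev_chain hA, List.map_replicate,
    List.prod_replicate]

/-- This replaces an appeal to the simplicity of the Valentiner group. In the quotient by the normal
subgroup N the classes of Z₁ and Z₂ are trivial, and then those of P, T₁ and Q vanish in turn, each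
being killed by two coprime exponents. -/
theorem linearValentiner_le_V6 : linearValentiner ≤ V6 := by
  let N : Subgroup linearValentiner := V6.subgroupOf linearValentiner
  have hN : N.Normal := ⟨fun x hx w => conj_mem_V6 w.2 hx⟩
  let π : linearValentiner →* linearValentiner ⧸ N := QuotientGroup.mk' N
  have hπ : ∀ x : linearValentiner, π x = 1 ↔ (x : GL (Fin 3) ℂ) ∈ V6 := fun x =>
    QuotientGroup.eq_one_iff x
  let z₁ : linearValentiner := ⟨Z1, Z1_mem⟩
  let z₂ : linearValentiner := ⟨Z2, Z2_mem⟩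
  let t : linearValentiner := ⟨T1, T1_mem⟩
  let p : linearValentiner := ⟨P, P_mem⟩
  let q : linearValentiner := ⟨Q, Q_mem⟩
  have hz₁ : π z₁ = 1 := (hπ z₁).mpr <| by
    have h := mul_mem neg_one_mem_V6 (Subgroup.subset_closure neg_Z1_mem_reflections)
    rwa [neg_mul_neg, one_mul] at h
  have hz₂ : π z₂ = 1 := by
    have h : t * z₁ * t⁻¹ = z₂ := Subtype.ext T1_mul_Z1
    rw [← h, map_mul, map_mul, hz₁, mul_one, map_inv, mul_inv_cancel]
  have eq_one {x : linearValentiner ⧸ N} {a b : ℕ} (hab : a.Coprime b) (ha : x ^ a = 1)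
      (hb : x ^ b = 1) : x = 1 := by
    have := Nat.dvd_gcd (orderOf_dvd_of_pow_eq_one ha) (orderOf_dvd_of_pow_eq_one hb)
    rw [hab] at this
    exact orderOf_eq_one_iff.mp (Nat.dvd_one.mp this)
  have rel {l : List linearValentiner} {k : ℕ}
      (h : (l.map Subtype.val).prod ^ k = (1 : GL (Fin 3) ℂ)) : (l.map π).prod ^ k = 1 := by
    have h' : l.prod ^ k = 1 := Subtype.ext <| by
      rw [SubmonoidClass.coe_pow, OneMemClass.coe_one, ← h]
      congr 1
      exact map_list_prod linearValentiner.subtype l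
    rw [← map_list_prod, ← map_pow, h', map_one]
  -- P⁵ = 1 and (Z₂P)³ = 1; since Z₂ becomes trivial, the class of P is killed by both 5 and 3.
  have hp : π p = 1 := by
    have h₅ := rel (l := [p]) (k := 5) (pow_eq_one_of_chain (w := [.P]) (A := .P)
      (by simp [p, coe_P]) (by decide +kernel) (by decide +kernel))
    have h₃ := rel (l := [z₂, p]) (k := 3) (pow_eq_one_of_chain (w := [.Z2, .P]) (A := .prod .Z2 .P)
      (by simp [z₂, p, coe_P, coe_Z2]) (by decide +kernel) (by decide +kernel))
    simp only [List.map_cons, List.map_nil, List.prod_cons, List.prod_nil, mul_one, hz₂,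
      one_mul] at h₅ h₃
    exact eq_one (by norm_num) h₅ h₃
  have ht : π t = 1 := by
    have h₃ := rel (l := [t]) (k := 3) (pow_eq_one_of_chain (w := [.T1]) (A := .T1)
      (by simp [t, coe_T1]) (by decide +kernel) (by decide +kernel))
    have h₅ := rel (l := [t, p]) (k := 5) (pow_eq_one_of_chain (w := [.T1, .P]) (A := .prod .T1 .P)
      (by simp [t, p, coe_P, coe_T1]) (by decide +kernel) (by decide +kernel))
    simp only [List.map_cons, List.map_nil, List.prod_cons, List.prod_nil, mul_one, hp] at h₅ h₃
    exact eq_one (by norm_num) h₅ h₃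
  have hq : π q = 1 := by
    have h₄ := rel (l := [q]) (k := 4) (pow_eq_one_of_chain (w := [.Q]) (A := .Q)
      (by simp [q, coe_Q]) (by decide +kernel) (by decide +kernel))
    have h₃ := rel (l := [p, z₁, q]) (k := 3) (pow_eq_one_of_chain (w := [.P, .Z1, .Q])
      (A := .prod .P (.prod .Z1 .Q))
      (by simp [p, z₁, q, coe_P, coe_Z1, coe_Q]) (by decide +kernel) (by decide +kernel))
    simp only [List.map_cons, List.map_nil, List.prod_cons, List.prod_nil, mul_one, hp, hz₁,
      one_mul] at h₄ h₃
    exact eq_one (by norm_num) h₄ h₃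
  rw [linearValentiner, Subgroup.closure_le]
  intro g hg
  simp only [Set.mem_insert_iff, Set.mem_singleton_iff] at hg
  rcases hg with rfl | rfl | rfl | rfl | rfl
  exacts [(hπ z₁).mp hz₁, (hπ z₂).mp hz₂, (hπ t).mp ht, (hπ p).mp hp, (hπ q).mp hq]

theorem mem_V6_iff {g : GL (Fin 3) ℂ} :
    g ∈ V6 ↔ g ∈ linearValentiner ∨ -g ∈ linearValentiner := by
  refine ⟨mem_or_neg_mem_of_mem_V6, ?_⟩
  rintro (h | h)
  · exact linearValentiner_le_V6 h
  · simpa using mul_mem neg_one_mem_V6 (linearValentiner_le_V6 h)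

theorem natCard_V6 : Nat.card V6 = 2160 := by
  have hV : Nat.card linearValentiner = 1080 := by
    rw [Nat.card_eq_fintype_card, card_linearValentiner]
  have hset : (V6 : Set (GL (Fin 3) ℂ)) =
      (linearValentiner : Set (GL (Fin 3) ℂ)) ∪ (fun g => -g) '' linearValentiner := by
    ext g
    simp [mem_V6_iff]
  have hfin : (linearValentiner : Set (GL (Fin 3) ℂ)).Finite :=
    Set.finite_coe_iff.mp (inferInstanceAs (Finite linearValentiner))
  have hdisj : Disjoint (linearValentiner : Set (GL (Fin 3) ℂ))
      ((fun g => -g) '' (linearValentiner : Set (GL (Fin 3) ℂ))) := by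
    rw [Set.disjoint_left]
    rintro _ hg ⟨h, hh, rfl⟩
    have e := det_of_mem_linearValentiner hg
    rw [Units.val_neg, Matrix.det_neg, det_of_mem_linearValentiner hh, Fintype.card_fin] at e
    norm_num at e
  change Nat.card (V6 : Set (GL (Fin 3) ℂ)) = 2160
  rw [Nat.card_coe_set_eq, hset, Set.ncard_union_eq hdisj hfin (hfin.image _),
    Set.ncard_image_of_injective _ neg_injective, ← Nat.card_coe_set_eq]
  change Nat.card linearValentiner + Nat.card linearValentiner = 2160
  rw [hV]

/-! ### The Molien series of the reflection group -/

theorem linSubst_neg_one {n m : ℕ} {F : MvPolynomial (Fin n) ℂ} (hF : F.IsHomogeneous m) :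
    linSubst (-1) F = (-1 : ℂ) ^ m • F := by
  have hdiag : (-1 : Matrix (Fin n) (Fin n) ℂ) = Matrix.diagonal fun _ => -1 := by
    rw [← Matrix.diagonal_one, Matrix.diagonal_neg]
  conv_lhs => rw [F.as_sum]
  conv_rhs => rw [F.as_sum]
  rw [map_sum, Finset.smul_sum]
  refine Finset.sum_congr rfl fun d hd => ?_
  have hdeg : ∑ i, d i = m := by
    rw [← Finsupp.degree_eq_sum, Finsupp.degree_eq_weight_one]
    exact hF (MvPolynomial.mem_support_iff.mp hd)
  have hmon : MvPolynomial.monomial d (F.coeff d) = F.coeff d • MvPolynomial.monomial d (1 : ℂ) := by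
    rw [MvPolynomial.smul_monomial, smul_eq_mul, mul_one]
  rw [hmon, map_smul, hdiag, linSubst_diagonal_monomial, Finset.prod_pow_eq_pow_sum, hdeg, smul_comm]

theorem homogeneousInvariants_V6_of_even {m : ℕ} (hm : Even m) :
    homogeneousInvariants V6 m = homogeneousInvariants V3 m := by
  rw [V3_eq_linearValentiner]
  ext F
  refine ⟨fun h => ⟨h.1, fun T hT => h.2 T (linearValentiner_le_V6 hT)⟩, fun h => ⟨h.1, ?_⟩⟩
  intro T hT
  rcases mem_V6_iff.mp hT with hT | hT
  · exact h.2 T hT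
  · have e : ((T⁻¹ : GL (Fin 3) ℂ) : Matrix (Fin 3) (Fin 3) ℂ) =
        (((-T)⁻¹ : GL (Fin 3) ℂ) : Matrix (Fin 3) (Fin 3) ℂ) * -1 := by
      rw [inv_neg, Units.val_neg, neg_mul_neg, mul_one]
    rw [e, linSubst_mul, h.2 _ hT, linSubst_neg_one h.1, hm.neg_one_pow, one_smul]

theorem homogeneousInvariants_V6_of_odd {m : ℕ} (hm : Odd m) :
    homogeneousInvariants V6 m = ⊥ := by
  rw [eq_bot_iff]
  intro F h
  have e := h.2 _ neg_one_mem_V6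
  rw [inv_neg, inv_one, Units.val_neg, Units.val_one, linSubst_neg_one h.1, hm.neg_one_pow,
    neg_smul, one_smul] at e
  exact (Submodule.mem_bot ℂ).mpr (self_eq_neg.mp e.symm)

theorem constantCoeff_molienDenominator (K : Type*) [Field K] :
    PowerSeries.constantCoeff (molienDenominator K) ≠ 0 := by
  simp [molienDenominator]

/-- The denominator is invariant under t ↦ -t, hence so is its inverse. -/
theorem coeff_inv_molienDenominator_of_odd {m : ℕ} (hm : Odd m) :
    PowerSeries.coeff m (molienDenominator ℚ)⁻¹ = 0 := by
  have hinv := PowerSeries.mul_inv_cancel _ (constantCoeff_molienDenominator ℚ)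
  have hden : PowerSeries.evalNegHom (molienDenominator ℚ) = molienDenominator ℚ := by
    simp only [molienDenominator, map_mul, map_sub, map_one, map_pow, PowerSeries.evalNegHom_X]
    ring
  have h : PowerSeries.evalNegHom (molienDenominator ℚ)⁻¹ = (molienDenominator ℚ)⁻¹ := by
    have h' := congrArg PowerSeries.evalNegHom hinv
    rw [map_mul, hden, map_one, mul_comm] at h'
    exact left_inv_eq_right_inv h' hinv
  have hc := congrArg (PowerSeries.coeff m) h
  rw [PowerSeries.evalNegHom, PowerSeries.coeff_rescale, hm.neg_one_pow] at hc
  linarith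

theorem molienSeries_V3 :
    molienSeries V3 = (1 + PowerSeries.X ^ 45) * (molienDenominator ℚ)⁻¹ :=
  (PowerSeries.eq_mul_inv_iff_mul_eq (constantCoeff_molienDenominator ℚ)).mpr
    molienSeries_V3_mul

theorem molienSeries_V6 : molienSeries V6 = (molienDenominator ℚ)⁻¹ := by
  ext m
  rcases Nat.even_or_odd m with hm | hm
  · have h₃ : PowerSeries.coeff m (molienSeries V6) = PowerSeries.coeff m (molienSeries V3) := by
      rw [molienSeries, molienSeries, PowerSeries.coeff_mk, PowerSeries.coeff_mk,
        homogeneousInvariants_V6_of_even hm]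
    rw [h₃, molienSeries_V3, add_mul, one_mul, map_add, PowerSeries.coeff_X_pow_mul']
    split_ifs with h
    · rw [coeff_inv_molienDenominator_of_odd (Nat.Even.sub_odd h hm (by decide)), add_zero]
    · rw [add_zero]
  · rw [coeff_inv_molienDenominator_of_odd hm, molienSeries, PowerSeries.coeff_mk,
      homogeneousInvariants_V6_of_odd hm, finrank_bot, Nat.cast_zero]

/-! ### Initial coefficients and conclusion -/

theorem trunc_of_mul_molienDenominator {f r : PowerSeries ℚ}
    (hf : f * molienDenominator ℚ = 1 + PowerSeries.X ^ 19 * r) :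
    PowerSeries.trunc 19 f =
      1 + Polynomial.X ^ 6 + 2 * Polynomial.X ^ 12 + 2 * Polynomial.X ^ 18 := by
  let p : Polynomial ℚ := 1 + Polynomial.X ^ 6 + 2 * Polynomial.X ^ 12 + 2 * Polynomial.X ^ 18
  have hdvd : (PowerSeries.X : PowerSeries ℚ) ^ 19 ∣ f - p := by
    have hunit : IsUnit (molienDenominator ℚ) :=
      IsUnit.of_mul_eq_one _ (PowerSeries.mul_inv_cancel _ (constantCoeff_molienDenominator ℚ))
    rw [← hunit.dvd_mul_right, sub_mul, hf]
    have h2 : ((2 : Polynomial ℚ) : PowerSeries ℚ) = 2 :=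
      map_ofNat Polynomial.coeToPowerSeries.ringHom 2
    have hp : (p : PowerSeries ℚ) = 1 + PowerSeries.X ^ 6 + 2 * PowerSeries.X ^ 12
        + 2 * PowerSeries.X ^ 18 := by
      simp only [p, Polynomial.coe_add, Polynomial.coe_mul, Polynomial.coe_pow, Polynomial.coe_one,
        Polynomial.coe_X, h2]
    rw [hp, molienDenominator]
    generalize (PowerSeries.X : PowerSeries ℚ) = x
    -- The bracket is the quotient of 1 - p · (denominator) by x¹⁹; its first term reflects the
    -- discrepancy 3x²⁴.
    exact ⟨r + (3 * x ^ 5 + x ^ 11 - 2 * x ^ 17 - 3 * x ^ 35 + 2 * x ^ 47), by ring⟩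
  have htrunc : PowerSeries.trunc 19 f = PowerSeries.trunc 19 (p : PowerSeries ℚ) := by
    ext k
    rw [PowerSeries.coeff_trunc, PowerSeries.coeff_trunc]
    split_ifs with hk
    · exact sub_eq_zero.mp ((map_sub _ _ _).symm.trans (PowerSeries.X_pow_dvd_iff.mp hdvd k hk))
    · rfl
  rw [htrunc]
  refine PowerSeries.trunc_coe_eq_self ?_
  exact Nat.lt_succ_of_le (by unfold p; compute_degree)

end Valentiner

end

theorem mainTheorem3 :
    (Nat.card Valentiner.V3 = 1080 ∧
      Valentiner.molienSeries Valentiner.V3 =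
        (1 + PowerSeries.X ^ 45) *
          ((1 - PowerSeries.X ^ 6) * (1 - PowerSeries.X ^ 12) * (1 - PowerSeries.X ^ 30))⁻¹ ∧
      PowerSeries.trunc 19 (Valentiner.molienSeries Valentiner.V3) =
        1 + Polynomial.X ^ 6 + 2 * Polynomial.X ^ 12 + 2 * Polynomial.X ^ 18 ∧
      PowerSeries.coeff 45 (Valentiner.molienSeries Valentiner.V3) = 1) ∧
    (Nat.card Valentiner.V6 = 2160 ∧
      Valentiner.molienSeries Valentiner.V6 =
        ((1 - PowerSeries.X ^ 6) * (1 - PowerSeries.X ^ 12) * (1 - PowerSeries.X ^ 30))⁻¹ ∧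
      PowerSeries.trunc 19 (Valentiner.molienSeries Valentiner.V6) =
        1 + Polynomial.X ^ 6 + 2 * Polynomial.X ^ 12 + 2 * Polynomial.X ^ 18) := by
  refine ⟨⟨Valentiner.natCard_V3, Valentiner.molienSeries_V3, ?_, ?_⟩,
    Valentiner.natCard_V6, Valentiner.molienSeries_V6, ?_⟩
  -- 45 = 19 + 26.
  · refine Valentiner.trunc_of_mul_molienDenominator (r := PowerSeries.X ^ 26) ?_
    rw [Valentiner.molienSeries_V3_mul, ← pow_add]
  -- The inverse denominator has no term of odd degree 45, so the coefficient is its constant term,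
  -- shifted by t⁴⁵.
  · rw [Valentiner.molienSeries_V3, add_mul, one_mul, map_add, PowerSeries.coeff_X_pow_mul',
      Valentiner.coeff_inv_molienDenominator_of_odd (by decide)]
    simp [Valentiner.molienDenominator]
  · refine Valentiner.trunc_of_mul_molienDenominator (r := 0) ?_
    rw [Valentiner.molienSeries_V6, mul_zero, add_zero,
      PowerSeries.inv_mul_cancel _ (Valentiner.constantCoeff_molienDenominator ℚ)]
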